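/- **Theorem.** *Setting.* Let $E\neq\{0\}$ be a finite-dimensional real normed space with norm $\|\cdot\|$, dual $E^*$, dual norm $\|\cdot\|_*$ and closed unit ball $B$. Let $\theta:B\to\mathbb R$ be convex and continuous with $0\in\operatorname{argmin}_B\theta$, and let $\theta'$ be a selection of the subdifferential $\partial\theta$ of $\theta$ on $B^o=\{x\in B:\partial\theta(x)\ne\emptyset\}$ which is continuous on $B^o$ and satisfies $\langle\theta'(x)-\theta'(x'),x-x'\rangle\ge\|x-x'\|^2$ for all $x,x'\in B^o$. Put $\Theta=\max_B\theta-\min_B\theta$. Let $X\subset E$ be convex and compact, $x_0\in X$, $R>0$, $\max_{x\in X}\|x-x_0\|\le R$, and put $\vartheta(x)=R^2\theta((x-x_0)/R)$, $\vartheta'(x)=R\,\theta'((x-x_0)/R)$, $V_x(z)=\vartheta(z)-\vartheta(x)-\langle\vartheta'(x),z-x\rangle$. Let $P$ be a probability measure on $\Omega$ and $\Phi:X\times\Omega\to\mathbb R$ be such that $\phi(x)=\int\Phi(x,\omega)\,dP(\omega)$ is finite, convex and differentiable on $X$, with a gradient satisfying $\|\nabla\phi(x')-\nabla\phi(x)\|_*\le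 L\|x-x'\|$ for $x,x'\in X$, where $L\ge0$. Let $\psi:X\to\mathbb R$ be convex and continuous, $F=\phi+\psi$, $F_*=\min_XF$. Let the (measurable) oracle $G:X\times\Omega\to E^*$ satisfy $\mathbb E\,G(x,\omega)=\nabla\phi(x)$ and $\mathbb E\|G(x,\omega)-\nabla\phi(x)\|_*^2\le\sigma^2$ for all $x\in X$, where $\sigma>0$. Let $\bar x\in X$, $g(\bar x)\in E^*$ and $\upsilon\ge0$ be such that $\|g(\bar x)-\nabla\phi(\bar x)\|_*\le\upsilon\sigma$. Put $M=LR$. *Algorithm (RSMD).* Let $N\ge1$ be an integer with $N\ge\upsilon^2$, let $\bar\beta>0$ with $\bar\beta\ge2L$, and let $$\lambda=\max\{\sigma\sqrt N,M\}+\upsilon\sigma .$$ For i.i.d. $\omega_1,\dots,\omega_N$ with law $P$ and $i=1,\dots,N$ define $$x_i=\operatorname*{argmin}_{z\in X}\big\{\langle y_i,z\rangle+\psi(z)+\bar\beta V_{x_{i-1}}(z)\big\},$$ where $y_i=G(x_{i-1},\omega_i)$ if $\|G(x_{i-1},\omega_i)-g(\bar x)\|_*\le L\|\bar x-x_{i-1}\|+\lambda+\upsilon\sigma$,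 and $y_i=g(\bar x)$ otherwise. Let $\widehat x_N=N^{-1}\sum_{i=1}^Nx_i$ and $$\varepsilon(x^N,z)=\sum_{i=1}^N\Big\{\bar\beta^{-1}\big[\langle\nabla\phi(x_{i-1}),x_i-z\rangle+\psi(x_i)-\psi(z)\big]+\tfrac12V_{x_{i-1}}(x_i)\Big\}.$$ *Claim.* There is a universal numerical constant $C>0$ such that, in every such setting and for every $\tau\in\mathbb R$, there is an event $\mathcal A_N\subset\Omega^N$ with $P^{\otimes N}(\mathcal A_N)\ge1-2e^{-\tau}$ on which $$F(\widehat x_N)-F_*\le\frac{\bar\beta}N\sup_{z\in X}\varepsilon(x^N,z)\le\frac CN\Big(\bar\beta R^2\Theta+\tau R\max\{\sigma\sqrt N,M\}+\tau\bar\beta^{-1}\max\{N\sigma^2,M^2\}\Big).$$ In particular, if $\bar\beta=\max\big\{2L,\frac{\sigma\sqrt N}{R\sqrt\Theta}\big\}$, then on $\mathcal A_N$ $$F(\widehat x_N)-F_*\le\frac{\bar\beta}N\sup_{z\in X}\varepsilon(x^N,z)\le C\max\Big\{\frac{LR^2\max\{\tau,\Theta\}}N,\ \tau\sigma R\sqrt{\frac\Theta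 N}\Big\}.$$ -/

import Mathlib

open MeasureTheory Set Metric

noncomputable section

namespace RSMD

universe u v

/-- The subdifferential at `x` of the function `f : S → ℝ` (as a function on the set `S`). -/
def subdiff {E : Type u} [NormedAddCommGroup E] [NormedSpace ℝ E]
    (f : E → ℝ) (S : Set E) (x : E) : Set (StrongDual ℝ E) :=
  {s | ∀ z ∈ S, f x + s (z - x) ≤ f z}

/-- The set `B° = {x ∈ B : ∂θ(x) ≠ ∅}`, where `B` is the closed unit ball. -/
def proxyDom {E : Type u} [NormedAddCommGroup E] [NormedSpace ℝ E] (θ : E → ℝ) : Set E :=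
  {x | x ∈ closedBall (0 : E) 1 ∧ (subdiff θ (closedBall (0 : E) 1) x).Nonempty}

/-- `θ` is a normalized proxy function on the unit ball, `θ'` is a version of its subgradient that
is continuous on `B°`, and `θ` is minimal at the origin. Only the values of `θ` on the unit ball
and of `θ'` on `B°` matter. -/
structure IsNormalizedProxy {E : Type u} [NormedAddCommGroup E] [NormedSpace ℝ E]
    (θ : E → ℝ) (θ' : E → StrongDual ℝ E) : Prop where
  convex : ConvexOn ℝ (closedBall (0 : E) 1) θ
  continuous : ContinuousOn θ (closedBall (0 : E) 1)
  subgradient : ∀ x ∈ proxyDom θ, θ' x ∈ subdiff θ (closedBall (0 : E) 1) x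
  continuous_subgradient : ContinuousOn θ' (proxyDom θ)
  strong : ∀ x ∈ proxyDom θ, ∀ x' ∈ proxyDom θ, ‖x - x'‖ ^ 2 ≤ (θ' x - θ' x') (x - x')
  min_zero : IsMinOn θ (closedBall (0 : E) 1) 0

/-- The data of a convex composite stochastic optimization problem with a stochastic oracle,
together with the data used by the algorithm. This structure carries no assumptions; functions of
a point of the feasible set `X` are functions on `E` whose values outside `X` are irrelevant. -/
structure Data (E : Type u) [NormedAddCommGroup E] [NormedSpace ℝ E] (Ω : Type v) where
  /-- feasible set -/
  X : Set E
  /-- random objective -/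
  Φ : E → Ω → ℝ
  /-- deterministic (composite) part of the objective -/
  ψ : E → ℝ
  /-- gradient of the expectation of the random objective -/
  gradφ : E → StrongDual ℝ E
  /-- stochastic oracle -/
  G : E → Ω → StrongDual ℝ E
  /-- Lipschitz constant of the gradient -/
  L : ℝ
  /-- noise level of the oracle -/
  σ : ℝ
  /-- normalized proxy function -/
  θ : E → ℝ
  /-- continuous version of its subgradient -/
  θ' : E → StrongDual ℝ E
  /-- starting point -/
  x₀ : E
  /-- radius of a ball around the starting point that contains `X` -/
  R : ℝ
  /-- reference point -/
  xbar : E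
  /-- approximate gradient at the reference point -/
  gbar : StrongDual ℝ E
  /-- relative accuracy of `gbar` -/
  υ : ℝ

namespace Data

variable {E : Type u} [NormedAddCommGroup E] [NormedSpace ℝ E] {Ω : Type v}

/-- `φ(x) = 𝔼 Φ(x, ω)`. -/
def φ [MeasurableSpace Ω] (D : Data E Ω) (P : Measure Ω) (x : E) : ℝ := ∫ w, D.Φ x w ∂P

/-- The objective `F = φ + ψ`. -/
def F [MeasurableSpace Ω] (D : Data E Ω) (P : Measure Ω) (x : E) : ℝ := D.φ P x + D.ψ x

/-- The optimal value `F_*` of the objective on `X`. -/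
def Fmin [MeasurableSpace Ω] (D : Data E Ω) (P : Measure Ω) : ℝ := sInf (D.F P '' D.X)

/-- `Θ = max_B θ - min_B θ`. -/
def Θ (D : Data E Ω) : ℝ :=
  sSup (D.θ '' closedBall (0 : E) 1) - sInf (D.θ '' closedBall (0 : E) 1)

/-- `M = L R`. -/
def M (D : Data E Ω) : ℝ := D.L * D.R

/-- The proxy function `ϑ(x) = R² θ((x - x₀) / R)` of `X`. -/
def proxy (D : Data E Ω) (x : E) : ℝ := D.R ^ 2 * D.θ (D.R⁻¹ • (x - D.x₀))

/-- Its subgradient `ϑ'(x) = R θ'((x - x₀) / R)`. -/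
def proxy' (D : Data E Ω) (x : E) : StrongDual ℝ E := D.R • D.θ' (D.R⁻¹ • (x - D.x₀))

/-- The Bregman divergence `V_x(z)`. -/
def V (D : Data E Ω) (x z : E) : ℝ := D.proxy z - D.proxy x - D.proxy' x (z - x)

/-- The assumptions on the problem, the proxy function, the oracle and the reference point. -/
structure Assumptions [MeasurableSpace E] [MeasurableSpace Ω] (D : Data E Ω) (P : Measure Ω) :
    Prop where
  convex_X : Convex ℝ D.X
  compact_X : IsCompact D.X
  x₀_mem : D.x₀ ∈ D.X
  R_pos : 0 < D.R
  dist_le : ∀ x ∈ D.X, ‖x - D.x₀‖ ≤ D.R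
  proxy : IsNormalizedProxy D.θ D.θ'
  integrable_Φ : ∀ x ∈ D.X, Integrable (D.Φ x) P
  convex_φ : ConvexOn ℝ D.X (D.φ P)
  hasGrad_φ : ∀ x ∈ D.X, HasFDerivWithinAt (D.φ P) (D.gradφ x) D.X x
  L_nonneg : 0 ≤ D.L
  lipschitz_grad : ∀ x ∈ D.X, ∀ x' ∈ D.X, ‖D.gradφ x' - D.gradφ x‖ ≤ D.L * ‖x - x'‖
  convex_ψ : ConvexOn ℝ D.X D.ψ
  continuous_ψ : ContinuousOn D.ψ D.X
  measurable_G : Measurable (fun p : D.X × Ω => D.G p.1 p.2)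
  σ_pos : 0 < D.σ
  integrable_G : ∀ x ∈ D.X, Integrable (D.G x) P
  unbiased : ∀ x ∈ D.X, ∫ w, D.G x w ∂P = D.gradφ x
  integrable_sq : ∀ x ∈ D.X, Integrable (fun w => ‖D.G x w - D.gradφ x‖ ^ 2) P
  variance_le : ∀ x ∈ D.X, ∫ w, ‖D.G x w - D.gradφ x‖ ^ 2 ∂P ≤ D.σ ^ 2
  xbar_mem : D.xbar ∈ D.X
  υ_nonneg : 0 ≤ D.υ
  gbar_close : ‖D.gbar - D.gradφ D.xbar‖ ≤ D.υ * D.σ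

/-- The composite proximal transform
`Prox_{β,x}(ξ) = argmin_{z ∈ X} (⟨ξ, z⟩ + ψ(z) + β V_x(z))`. For `β > 0` the minimizer exists by
compactness and continuity and is unique by strong convexity. -/
def prox (D : Data E Ω) (β : ℝ) (x : E) (ξ : StrongDual ℝ E) : E :=
  Classical.epsilon fun u => u ∈ D.X ∧ IsMinOn (fun z => ξ z + D.ψ z + β * D.V x z) D.X u

open Classical in
/-- The truncated stochastic gradient at the point `x` with truncation threshold `lam`. -/
def truncGrad (D : Data E Ω) (lam : ℝ) (x : E) (w : Ω) : StrongDual ℝ E :=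
  if ‖D.G x w - D.gbar‖ ≤ D.L * ‖D.xbar - x‖ + lam + D.υ * D.σ then D.G x w else D.gbar

/-- The iterates `x_0, x_1, …, x_N` of Robust Stochastic Mirror Descent; `ω i` is the oracle
sample used to pass from `x_i` to `x_{i+1}` (the sequence is constant after step `N`). -/
def iter (D : Data E Ω) (β : ℕ → ℝ) (lam : ℝ) {N : ℕ} (ω : Fin N → Ω) : ℕ → E
  | 0 => D.x₀
  | i + 1 =>
    if h : i < N then
      D.prox (β i) (D.iter β lam ω i) (D.truncGrad lam (D.iter β lam ω i) (ω ⟨i, h⟩))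
    else D.iter β lam ω i

/-- The approximate solution `N⁻¹ ∑_{i=1}^N x_i`. -/
def xhat (D : Data E Ω) (β : ℕ → ℝ) (lam : ℝ) {N : ℕ} (ω : Fin N → Ω) : E :=
  (N : ℝ)⁻¹ • ∑ i ∈ Finset.range N, D.iter β lam ω (i + 1)

/-- `ε(x^N, z) = ∑_{i=1}^N (β_{i-1}⁻¹ (⟨∇φ(x_{i-1}), x_i - z⟩ + ψ(x_i) - ψ(z))
+ V_{x_{i-1}}(x_i) / 2)` for points `x_0, …, x_N`. -/
def eps (D : Data E Ω) (β : ℕ → ℝ) (N : ℕ) (x : ℕ → E) (z : E) : ℝ :=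
  ∑ i ∈ Finset.range N,
    ((β i)⁻¹ * (D.gradφ (x i) (x (i + 1) - z) + D.ψ (x (i + 1)) - D.ψ z)
      + 1 / 2 * D.V (x i) (x (i + 1)))

/-- `sup_{z ∈ X} ε(x^N, z)`, where the `x_i` are the iterates of the algorithm. -/
def supEps (D : Data E Ω) (β : ℕ → ℝ) (lam : ℝ) {N : ℕ} (ω : Fin N → Ω) : ℝ :=
  sSup (D.eps β N (D.iter β lam ω) '' D.X)

/-- The threshold `max {σ √N, M} + υ σ`, which does not depend on the confidence level. -/
def threshold (D : Data E Ω) (N : ℕ) : ℝ := max (D.σ * √(N : ℝ)) D.M + D.υ * D.σ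

end Data

end RSMD

end

noncomputable section

namespace RSMD

open Filter Topology

universe u v

/-! ### Convex analysis: tangents, descent lemma, existence of subgradients -/

section Convex

variable {E : Type u} [NormedAddCommGroup E] [NormedSpace ℝ E]

/-! Write ξ_i = y_i − ∇φ(x_{i-1}), ζ_i = G(x_{i-1}, ω_i) − ∇φ(x_{i-1}) and K = max{σ√N, M}. The prox
inequality (`prox_step`) telescopes in V_{x_i}(z) and leaves β⁻¹⟨ξ_i, z − x_{i-1}⟩ + β⁻²‖ξ_i‖².
Because of the supremum over z, which may depend on the whole sample, the linear term is not a
martingale difference. A ghost dual averaging sequence z_i driven by the same noise cures this: z is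
replaced by the predictable z_{i-1} at a total cost of R²Θ plus β⁻²‖ξ_i‖²/2 per step
(`dual_averaging_step`). Hence sup ε ≤ 2R²Θ + ∑ u_i with increments u_i free of z (`eps_le`).

Truncation makes u_i bounded although ζ_i has only a second moment: ‖ξ_i‖ ≤ 8K, ‖ξ_i‖ ≤ 2‖ζ_i‖, and
the error ⟨ξ_i − ζ_i, v⟩ is at most 3‖v‖‖ζ_i‖²/K. With q = 16KRβ⁻¹ + 96K²β⁻² this gives 𝔼 exp(u_i/q)
≤ 1 + σ²/K² ≤ e^{1/N} from every state (`lintegral_exp_increment_le`). The product over N steps is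
at most e, and Markov's inequality gives ∑ u_i ≤ (1 + τ)q outside an event of probability e^{-τ}
(`exists_event`). Since q does not involve τ, neither does the threshold.

The comparison of F with ε is deterministic: tangent inequality, descent lemma with β ≥ 2L, and
Jensen (`F_sub_Fmin_le`). -/

theorem le_of_forall_le_combo {a b c : ℝ}
    (h : ∀ t : ℝ, 0 < t → t ≤ 1 → c ≤ (1 - t) * a + t * b) : c ≤ a := by
  have h1 : Tendsto (fun t : ℝ => (1 - t) * a + t * b) (𝓝[>] 0) (𝓝 ((1 - 0) * a + 0 * b)) :=
    (Continuous.tendsto (by fun_prop) 0).mono_left nhdsWithin_le_nhds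
  have h2 : c ≤ (1 - 0) * a + 0 * b := by
    refine ge_of_tendsto h1 ?_
    filter_upwards [Ioc_mem_nhdsGT (zero_lt_one' ℝ)] with t ht using h t ht.1 ht.2
  simpa using h2

/-- Integration of an affine lower bound on the slope of a function, by Riemann sums. -/
theorem add_half_le_of_slope_le {g : ℝ → ℝ} {c m K : ℝ}
    (h : ∀ s t : ℝ, 0 ≤ s → s < t → t ≤ 1 →
      (t - s) * (c + m * s) - K * (t - s) ^ 2 ≤ g t - g s) :
    c + m / 2 ≤ g 1 - g 0 := by
  -- The hypothesis is summed over n + 1 equal subintervals; both the left-endpoint error and the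
  -- K-terms are O(1/n).
  have key : ∀ n : ℕ, c + m / 2 - (m / 2 + K) * (1 / ((n : ℝ) + 1)) ≤ g 1 - g 0 := by
    intro n
    have hn : (0 : ℝ) < n + 1 := by positivity
    have step : ∀ k ∈ Finset.range (n + 1),
        (1 / ((n : ℝ) + 1)) * (c + m * (k / (n + 1))) - K * (1 / ((n : ℝ) + 1)) ^ 2
          ≤ g (((k + 1 : ℕ) : ℝ) / (n + 1)) - g ((k : ℝ) / (n + 1)) := by
      intro k hk
      have hk' : (k : ℝ) + 1 ≤ n + 1 := by
        exact_mod_cast Finset.mem_range.mp hk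
      have := h (k / (n + 1)) (((k + 1 : ℕ) : ℝ) / (n + 1)) (by positivity)
        (by push_cast; gcongr; linarith) (by push_cast; rw [div_le_one hn]; exact hk')
      have e : ((k + 1 : ℕ) : ℝ) / (n + 1) - k / (n + 1) = 1 / ((n : ℝ) + 1) := by
        push_cast; ring
      rwa [e] at this
    have hs := Finset.sum_le_sum step
    rw [Finset.sum_range_sub (fun k : ℕ => g ((k : ℝ) / (n + 1)))] at hs
    have hsum : ∑ k ∈ Finset.range (n + 1), (k : ℝ) = (n + 1) * n / 2 := by
      have := Finset.sum_range_id_mul_two (n + 1)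
      rw [Nat.add_sub_cancel] at this
      have h2 := congrArg (Nat.cast (R := ℝ)) this
      push_cast at h2
      linarith
    have e2 : ∑ k ∈ Finset.range (n + 1),
        ((1 / ((n : ℝ) + 1)) * (c + m * (k / (n + 1))) - K * (1 / ((n : ℝ) + 1)) ^ 2)
        = c + m / 2 - (m / 2 + K) * (1 / ((n : ℝ) + 1)) := by
      have : ∀ k : ℕ, (1 / ((n : ℝ) + 1)) * (c + m * (k / (n + 1))) - K * (1 / ((n : ℝ) + 1)) ^ 2
          = ((1 / ((n : ℝ) + 1)) * c - K * (1 / ((n : ℝ) + 1)) ^ 2)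
            + (m / (n + 1) ^ 2) * k := by
        intro k; field_simp; ring
      simp_rw [this]
      rw [Finset.sum_add_distrib, ← Finset.mul_sum, hsum]
      simp only [Finset.sum_const, Finset.card_range, nsmul_eq_mul]
      push_cast
      field_simp
      ring
    rw [e2] at hs
    simpa [div_self hn.ne'] using hs
  have lim : Tendsto (fun n : ℕ => c + m / 2 - (m / 2 + K) * (1 / ((n : ℝ) + 1))) atTop
      (𝓝 (c + m / 2 - (m / 2 + K) * 0)) :=
    tendsto_const_nhds.sub (tendsto_const_nhds.mul tendsto_one_div_add_atTop_nhds_zero_nat)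
  have := le_of_tendsto' lim key
  simpa using this

/-- A convex function lies above its tangents. -/
theorem tangent_le_of_convexOn {X : Set E} {f : E → ℝ} {f' : StrongDual ℝ E} {x z : E}
    (hf : ConvexOn ℝ X f) (hd : HasFDerivWithinAt f f' X x) (hx : x ∈ X) (hz : z ∈ X) :
    f x + f' (z - x) ≤ f z := by
  have hmem : ∀ n : ℕ, x + (1 / ((n : ℝ) + 1)) • (z - x) ∈ X := fun n =>
    hf.1.add_smul_sub_mem hx hz ⟨by positivity, by
      rw [div_le_one (by positivity)]; linarith [(Nat.cast_nonneg n : (0 : ℝ) ≤ n)]⟩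
  have hlim : Tendsto (fun n : ℕ => ((n : ℝ) + 1) • (f (x + (1 / ((n : ℝ) + 1)) • (z - x)) - f x))
      atTop (𝓝 (f' (z - x))) := by
    refine hd.lim ?_ (Eventually.of_forall hmem) ?_
    · simpa using (tendsto_one_div_add_atTop_nhds_zero_nat (𝕜 := ℝ)).smul_const (z - x)
    · refine tendsto_const_nhds.congr fun n => ?_
      have hn : ((n : ℝ) + 1) ≠ 0 := by positivity
      rw [smul_smul, mul_one_div_cancel hn, one_smul]
  have : f' (z - x) ≤ f z - f x := by
    refine le_of_tendsto' hlim fun n => ?_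
    have hn : (0 : ℝ) < n + 1 := by positivity
    have h1 : 1 / ((n : ℝ) + 1) ≤ 1 := by
      rw [div_le_one (by positivity)]; linarith [(Nat.cast_nonneg n : (0 : ℝ) ≤ n)]
    have := hf.2 hx hz (sub_nonneg.mpr h1) (by positivity : 0 ≤ 1 / ((n : ℝ) + 1)) (by ring)
    have e : (1 - 1 / ((n : ℝ) + 1)) • x + (1 / ((n : ℝ) + 1)) • z
        = x + (1 / ((n : ℝ) + 1)) • (z - x) := by module
    rw [e] at this
    simp only [smul_eq_mul] at this ⊢
    calc ((n : ℝ) + 1) * (f (x + (1 / ((n : ℝ) + 1)) • (z - x)) - f x)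
        ≤ ((n : ℝ) + 1) * ((1 / ((n : ℝ) + 1)) * (f z - f x)) := by
          gcongr; linarith
      _ = f z - f x := by field_simp
  linarith

/-- The descent lemma for a convex function with Lipschitz gradient on a convex set. -/
theorem le_tangent_add_of_lipschitz {X : Set E} {f : E → ℝ} {f' : E → StrongDual ℝ E} {L : ℝ}
    (hf : ConvexOn ℝ X f) (hd : ∀ x ∈ X, HasFDerivWithinAt f (f' x) X x)
    (hl : ∀ x ∈ X, ∀ x' ∈ X, ‖f' x' - f' x‖ ≤ L * ‖x - x'‖) {x z : E} (hx : x ∈ X) (hz : z ∈ X) :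
    f z ≤ f x + f' x (z - x) + L / 2 * ‖z - x‖ ^ 2 := by
  have hmem : ∀ t : ℝ, 0 ≤ t → t ≤ 1 → x + t • (z - x) ∈ X := fun t h0 h1 =>
    hf.1.add_smul_sub_mem hx hz ⟨h0, h1⟩
  have := add_half_le_of_slope_le (g := fun t => - f (x + t • (z - x))) (c := - f' x (z - x))
    (m := - (L * ‖z - x‖ ^ 2)) (K := L * ‖z - x‖ ^ 2) (by
      intro s t hs hst ht
      have hsX := hmem s hs (by linarith)
      have htX := hmem t (by linarith) ht
      -- The tangent is taken at the right endpoint t; moving its slope back to s costs L‖z − x‖²(t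
      -- − s)², which is why K is nonzero here.
      have h1 := tangent_le_of_convexOn hf (hd _ htX) htX hsX
      have e : x + s • (z - x) - (x + t • (z - x)) = -((t - s) • (z - x)) := by module
      rw [e, map_neg, map_smul, smul_eq_mul] at h1
      have h2 : f' (x + t • (z - x)) (z - x) ≤ f' x (z - x) + t * (L * ‖z - x‖ ^ 2) := by
        have h3 : (f' (x + t • (z - x)) - f' x) (z - x)
            ≤ ‖f' (x + t • (z - x)) - f' x‖ * ‖z - x‖ :=
          (le_abs_self _).trans ((f' (x + t • (z - x)) - f' x).le_opNorm (z - x))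
        have h4 := hl x hx _ htX
        have e2 : x - (x + t • (z - x)) = -(t • (z - x)) := by module
        rw [e2, norm_neg, norm_smul, Real.norm_of_nonneg (by linarith)] at h4
        rw [sub_apply] at h3
        have h5 : ‖f' (x + t • (z - x)) - f' x‖ * ‖z - x‖
            ≤ (L * (t * ‖z - x‖)) * ‖z - x‖ := by gcongr
        nlinarith
      have h6 := mul_le_mul_of_nonneg_left h2 (by linarith : 0 ≤ t - s)
      nlinarith)
  simp only [one_smul, zero_smul, add_zero, add_sub_cancel] at this
  linarith

/-- If `h + θ` attains its minimum over `X` at `y` and `X` meets the interior of the domain `S` of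
`θ`, then `θ` is subdifferentiable at `y`. -/
theorem subdiff_nonempty_of_isMinOn_add {S X : Set E} {θ h : E → ℝ} {a y : E}
    (hS : ConvexOn ℝ S θ) (hc : ContinuousOn θ S) (hX : ConvexOn ℝ X h)
    (haX : a ∈ X) (haS : a ∈ interior S) (hy : y ∈ X)
    (hmin : ∀ z ∈ X, h y + θ y ≤ h z + θ z) : (subdiff θ S y).Nonempty := by
  -- Hahn–Banach separates the strict epigraph of θ from the hypograph of the concave function h y +
  -- θ y − h. Restricting θ to the interior makes A open; minimality makes the sets disjoint.
  let A : Set (E × ℝ) := {p | p.1 ∈ interior S ∧ θ p.1 < p.2}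
  let B : Set (E × ℝ) := {p | p.1 ∈ X ∧ h p.1 + p.2 ≤ h y + θ y}
  have hAconv : Convex ℝ A := (hS.subset interior_subset hS.1.interior).convex_strict_epigraph
  have hBconv : Convex ℝ B := by
    intro p hp q hq s t hs ht hst
    refine ⟨hX.1 hp.1 hq.1 hs ht hst, ?_⟩
    have h1 := hX.2 hp.1 hq.1 hs ht hst
    have h2 := mul_le_mul_of_nonneg_left hp.2 hs
    have h3 := mul_le_mul_of_nonneg_left hq.2 ht
    have e : s * (h y + θ y) + t * (h y + θ y) = h y + θ y := by rw [← add_mul, hst, one_mul]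
    simp only [Prod.fst_add, Prod.smul_fst, Prod.snd_add, Prod.smul_snd, smul_eq_mul] at h1 ⊢
    linarith
  have hAopen : IsOpen A := by
    have hc1 : ContinuousOn (fun p : E × ℝ => θ p.1 - p.2) (interior S ×ˢ univ) :=
      ((hc.mono interior_subset).comp continuousOn_fst fun p hp => hp.1).sub continuousOn_snd
    have := hc1.isOpen_inter_preimage (isOpen_interior.prod isOpen_univ) (isOpen_Iio (a := (0 : ℝ)))
    convert this using 1
    ext p
    simp [A]
  have hdisj : Disjoint A B := by
    rw [Set.disjoint_left]
    intro p hp hq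
    have := hmin _ hq.1
    linarith [hp.2, hq.2]
  obtain ⟨f, u, hfA, hfB⟩ := geometric_hahn_banach_open hAconv hAopen hBconv hdisj
  let l : StrongDual ℝ E := f.comp (ContinuousLinearMap.inl ℝ E ℝ)
  set c : ℝ := f (0, 1) with hcdef
  have hf : ∀ z r, f (z, r) = l z + r * c := by
    intro z r
    have : ((z, r) : E × ℝ) = (z, 0) + r • (0, 1) := by simp
    rw [this, map_add, map_smul]; rfl
  have h1 : f (a, |θ a| + |h y + θ y - h a| + 1) < u :=
    hfA _ ⟨haS, by
      show θ a < _
      linarith [le_abs_self (θ a), abs_nonneg (h y + θ y - h a)]⟩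
  have h2 : u ≤ f (a, h y + θ y - h a) := hfB _ ⟨haX, by show h a + _ ≤ _; linarith⟩
  -- The separating hyperplane is not vertical, since A and B both contain points above the interior
  -- point a.
  have hcneg : c < 0 := by
    rw [hf] at h1 h2
    by_contra hcc
    push Not at hcc
    have : 0 ≤ (|θ a| + |h y + θ y - h a| + 1 - (h y + θ y - h a)) * c := by
      apply mul_nonneg _ hcc
      linarith [le_abs_self (h y + θ y - h a), abs_nonneg (θ a)]
    nlinarith
  have hBy : u ≤ l y + θ y * c := by
    rw [← hf]; exact hfB _ ⟨hy, le_refl _⟩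
  have hint : ∀ z ∈ interior S, l z + θ z * c ≤ l y + θ y * c := by
    intro z hz
    by_contra hlt
    push Not at hlt
    have h3 := hfA (z, θ z + (l z + θ z * c - (l y + θ y * c)) / (-c)) ⟨hz, by
      show θ z < _
      have : 0 < (l z + θ z * c - (l y + θ y * c)) / (-c) := div_pos (by linarith) (by linarith)
      linarith⟩
    rw [hf] at h3
    have e : (l z + θ z * c - (l y + θ y * c)) / (-c) * c = -(l z + θ z * c - (l y + θ y * c)) := by
      rw [div_neg, neg_mul, div_mul_cancel₀ _ hcneg.ne]
    rw [add_mul, e] at h3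
    linarith
  refine ⟨(-c)⁻¹ • l, fun z hz => ?_⟩
  have hz' : l z + θ z * c ≤ l y + θ y * c := by
    have : -(l y + θ y * c) ≤ -(l z + θ z * c) := by
      -- Boundary points of S are reached by moving z towards a, which enters the interior, and
      -- letting t → 0.
      refine le_of_forall_le_combo (b := -(l a + θ a * c)) fun t ht ht1 => ?_
      have hmem := hS.1.add_smul_sub_mem_interior hz haS ⟨ht, ht1⟩
      have h4 := hint _ hmem
      have h5 := hS.2 hz (interior_subset haS) (sub_nonneg.mpr ht1) ht.le (by ring)
      have e : (1 - t) • z + t • a = z + t • (a - z) := by module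
      rw [e] at h5
      have h6 : l (z + t • (a - z)) = (1 - t) * l z + t * l a := by
        rw [← e, map_add, map_smul, map_smul]; rfl
      rw [h6] at h4
      simp only [smul_eq_mul] at h5
      nlinarith
    linarith
  have e : ((-c)⁻¹ • l) (z - y) = (l z - l y) / (-c) := by
    rw [smul_apply, map_sub, smul_eq_mul]
    ring
  rw [e]
  have : (l z - l y) / (-c) ≤ θ z - θ y := by
    rw [div_le_iff₀ (by linarith)]; linarith
  linarith

end Convex

/-! ### The normalized proxy function -/

section Proxy

variable {E : Type u} [NormedAddCommGroup E] [NormedSpace ℝ E]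
  {θ : E → ℝ} {θ' : E → StrongDual ℝ E}

theorem ball_subset_proxyDom (hθ : IsNormalizedProxy θ θ') : ball (0 : E) 1 ⊆ proxyDom θ := by
  intro x hx
  refine ⟨ball_subset_closedBall hx, ?_⟩
  -- Over the singleton {x} minimality is trivial, so every interior point is a point of
  -- subdifferentiability.
  refine subdiff_nonempty_of_isMinOn_add (X := {x}) (h := fun _ => 0) (a := x) hθ.convex
    hθ.continuous (convexOn_const _ (convex_singleton x)) rfl
    (interior_maximal ball_subset_closedBall isOpen_ball hx) rfl ?_
  rintro z rfl
  exact le_rfl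

namespace IsNormalizedProxy

/-- Strong monotonicity of θ' integrated along the segment from x. For z in the open ball the
segment stays in B°, where θ' is a subgradient; continuity of θ covers the sphere. -/
theorem add_half_sq_le (hθ : IsNormalizedProxy θ θ') {x z : E} (hx : x ∈ proxyDom θ)
    (hz : z ∈ closedBall (0 : E) 1) : θ x + θ' x (z - x) + ‖z - x‖ ^ 2 / 2 ≤ θ z := by
  have main : ∀ z ∈ ball (0 : E) 1, θ x + θ' x (z - x) + ‖z - x‖ ^ 2 / 2 ≤ θ z := by
    intro z hz
    have hzI : z ∈ interior (closedBall (0 : E) 1) :=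
      interior_maximal ball_subset_closedBall isOpen_ball hz
    have hmem : ∀ t : ℝ, 0 ≤ t → t ≤ 1 → x + t • (z - x) ∈ proxyDom θ := by
      intro t h0 h1
      rcases h0.eq_or_lt with rfl | h0
      · simpa using hx
      · have := (convex_closedBall (0 : E) 1).add_smul_sub_mem_interior hx.1 hzI ⟨h0, h1⟩
        rw [interior_closedBall _ one_ne_zero] at this
        exact ball_subset_proxyDom hθ this
    have := add_half_le_of_slope_le (g := fun t => θ (x + t • (z - x))) (c := θ' x (z - x))
      (m := ‖z - x‖ ^ 2) (K := 0) (by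
        intro s t hs hst ht
        have hsX := hmem s hs (by linarith)
        have htX := hmem t (by linarith) ht
        have h1 := hθ.subgradient _ hsX _ htX.1
        have e : x + t • (z - x) - (x + s • (z - x)) = (t - s) • (z - x) := by module
        rw [e, map_smul, smul_eq_mul] at h1
        have h2 : θ' x (z - x) + s * ‖z - x‖ ^ 2 ≤ θ' (x + s • (z - x)) (z - x) := by
          rcases hs.eq_or_lt with rfl | hs
          · simp
          · have h3 := hθ.strong _ hsX _ hx
            have e2 : x + s • (z - x) - x = s • (z - x) := by module
            rw [e2, norm_smul, Real.norm_of_nonneg hs.le, map_smul, smul_eq_mul,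
              sub_apply] at h3
            have h4 : s * (s * ‖z - x‖ ^ 2)
                ≤ s * (θ' (x + s • (z - x)) (z - x) - θ' x (z - x)) := by nlinarith
            have := le_of_mul_le_mul_left h4 hs
            linarith
        have h6 := mul_le_mul_of_nonneg_left h2 (by linarith : 0 ≤ t - s)
        nlinarith)
    simp only [one_smul, zero_smul, add_zero, add_sub_cancel] at this
    linarith
  have hcl : z ∈ closure (ball (0 : E) 1) := by rwa [closure_ball _ one_ne_zero]
  refine ContinuousWithinAt.closure_le (f := fun z => θ x + θ' x (z - x) + ‖z - x‖ ^ 2 / 2) hcl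
    (Continuous.continuousWithinAt (by fun_prop))
    ((hθ.continuous z hz).mono ball_subset_closedBall) main

/-- Minimality at 0 only says that 0 is one of the subgradients there. The subgradient inequality at
tv, tested at 0, gives θ'(tv)v ≥ 0, and continuity of the selection then forces θ'(0)v ≥ 0 for all
±v. -/
theorem subgradient_zero (hθ : IsNormalizedProxy θ θ') : θ' 0 = 0 := by
  have h0 : ∀ v : E, 0 ≤ θ' 0 v := by
    intro v
    have hlim : Tendsto (fun t : ℝ => t • v) (𝓝[>] 0) (𝓝 0) := by
      have : Tendsto (fun t : ℝ => t • v) (𝓝 0) (𝓝 ((0 : ℝ) • v)) :=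
        Continuous.tendsto (by fun_prop) 0
      rw [zero_smul] at this
      exact this.mono_left nhdsWithin_le_nhds
    have hball : ∀ᶠ t : ℝ in 𝓝[>] 0, t • v ∈ ball (0 : E) 1 :=
      hlim (ball_mem_nhds 0 one_pos)
    have hcont : ContinuousAt θ' 0 :=
      hθ.continuous_subgradient.continuousAt
        (Filter.mem_of_superset (ball_mem_nhds 0 one_pos) (ball_subset_proxyDom hθ))
    have hl2 : Tendsto (fun t : ℝ => θ' (t • v) v) (𝓝[>] 0) (𝓝 (θ' 0 v)) :=
      ((ContinuousLinearMap.apply ℝ ℝ v).continuous.tendsto _).comp (hcont.tendsto.comp hlim)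
    refine ge_of_tendsto hl2 ?_
    filter_upwards [hball, self_mem_nhdsWithin] with t ht (htp : 0 < t)
    have h1 := hθ.subgradient _ (ball_subset_proxyDom hθ ht) 0 (by simp)
    have h2 : θ 0 ≤ θ (t • v) := hθ.min_zero (ball_subset_closedBall ht)
    rw [zero_sub, map_neg, map_smul, smul_eq_mul] at h1
    exact nonneg_of_mul_nonneg_right (by linarith : 0 ≤ t * θ' (t • v) v) htp
  ext v
  have h1 := h0 v
  have h2 := h0 (-v)
  rw [map_neg] at h2
  simp only [zero_apply]
  linarith

end IsNormalizedProxy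

end Proxy

end RSMD

end

noncomputable section

namespace RSMD

open Filter Topology

universe u v

/-! ### Bregman geometry: optimality and stability of prox steps -/

namespace Data

variable {E : Type u} [NormedAddCommGroup E] [NormedSpace ℝ E] {Ω : Type v}

/-- The points at which the proxy function has a subgradient. -/
def proxDom (D : Data E Ω) : Set E := {x | D.R⁻¹ • (x - D.x₀) ∈ proxyDom D.θ}

/-- A minimizer over `X` of `⟨η, z⟩ + h z + β ϑ(z)`. -/
def bregmanArgmin (D : Data E Ω) (h : E → ℝ) (β : ℝ) (η : StrongDual ℝ E) : E :=
  Classical.epsilon fun u => u ∈ D.X ∧ IsMinOn (fun z => η z + h z + β * D.proxy z) D.X u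

/-- The base point enters only through the dual vector ξ − βϑ'(x), so one minimization problem
serves both the iterates (h = ψ) and the ghost sequence (h = 0, β = 1). -/
theorem prox_eq_bregmanArgmin (D : Data E Ω) {β : ℝ} (x : E)
    (ξ : StrongDual ℝ E) : D.prox β x ξ = D.bregmanArgmin D.ψ β (ξ - β • D.proxy' x) := by
  unfold Data.prox Data.bregmanArgmin
  congr 1
  funext u
  congr 1
  have : ∀ z, ξ z + D.ψ z + β * D.V x z
      = (ξ - β • D.proxy' x) z + D.ψ z + β * D.proxy z
        + (β * D.proxy' x x - β * D.proxy x) := by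
    intro z
    simp only [Data.V, sub_apply, smul_apply, map_sub, smul_eq_mul]
    ring
  simp only [this, isMinOn_iff, add_le_add_iff_right]

namespace Assumptions

variable [MeasurableSpace E] [MeasurableSpace Ω] {D : Data E Ω} {P : Measure Ω}

theorem subset_closedBall (hD : D.Assumptions P) : D.X ⊆ closedBall D.x₀ D.R := fun x hx => by
  rw [mem_closedBall, dist_eq_norm]; exact hD.dist_le x hx

theorem scale_mem_closedBall (hD : D.Assumptions P) {x : E} (hx : x ∈ closedBall D.x₀ D.R) :
    D.R⁻¹ • (x - D.x₀) ∈ closedBall (0 : E) 1 := by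
  rw [mem_closedBall, dist_eq_norm] at hx
  rw [mem_closedBall_zero_iff, norm_smul, norm_inv, Real.norm_of_nonneg hD.R_pos.le]
  exact (inv_mul_le_one₀ hD.R_pos).mpr hx

theorem scale_mem_ball (hD : D.Assumptions P) {x : E} (hx : x ∈ ball D.x₀ D.R) :
    D.R⁻¹ • (x - D.x₀) ∈ ball (0 : E) 1 := by
  rw [mem_ball, dist_eq_norm] at hx
  rw [mem_ball_zero_iff, norm_smul, norm_inv, Real.norm_of_nonneg hD.R_pos.le]
  exact (inv_mul_lt_one₀ hD.R_pos).mpr hx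

theorem smul_scale_sub (hD : D.Assumptions P) (x z : E) :
    z - x = D.R • (D.R⁻¹ • (z - D.x₀) - D.R⁻¹ • (x - D.x₀)) := by
  rw [← smul_sub, smul_inv_smul₀ hD.R_pos.ne']
  abel

theorem ball_subset_proxDom (hD : D.Assumptions P) : ball D.x₀ D.R ⊆ D.proxDom := fun _ hx =>
  ball_subset_proxyDom hD.proxy (hD.scale_mem_ball hx)

theorem x₀_mem_proxDom (hD : D.Assumptions P) : D.x₀ ∈ D.proxDom :=
  hD.ball_subset_proxDom (mem_ball_self hD.R_pos)

theorem convexOn_proxy (hD : D.Assumptions P) : ConvexOn ℝ (closedBall D.x₀ D.R) D.proxy := by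
  refine ⟨convex_closedBall _ _, fun x hx z hz s t hs ht hst => ?_⟩
  have := hD.proxy.convex.2 (hD.scale_mem_closedBall hx) (hD.scale_mem_closedBall hz) hs ht hst
  have e : s • D.R⁻¹ • (x - D.x₀) + t • D.R⁻¹ • (z - D.x₀)
      = D.R⁻¹ • (s • x + t • z - D.x₀) := by
    have : D.x₀ = s • D.x₀ + t • D.x₀ := by rw [← add_smul, hst, one_smul]
    nth_rw 3 [this]
    module
  rw [e] at this
  have := mul_le_mul_of_nonneg_left this (sq_nonneg D.R)
  simp only [smul_eq_mul] at this ⊢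
  unfold Data.proxy
  linarith

theorem continuousOn_proxy (hD : D.Assumptions P) :
    ContinuousOn D.proxy (closedBall D.x₀ D.R) := by
  refine continuousOn_const.mul (hD.proxy.continuous.comp (by fun_prop) ?_)
  exact fun x hx => hD.scale_mem_closedBall hx

theorem continuousOn_proxy' (hD : D.Assumptions P) : ContinuousOn D.proxy' D.proxDom := by
  unfold Data.proxy'
  exact (hD.proxy.continuous_subgradient.comp (f := fun x => D.R⁻¹ • (x - D.x₀))
    (by fun_prop) fun x hx => hx).const_smul D.R

theorem half_sq_le_V (hD : D.Assumptions P) {x z : E} (hx : x ∈ D.proxDom) (hz : z ∈ D.X) :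
    ‖z - x‖ ^ 2 / 2 ≤ D.V x z := by
  have h := hD.proxy.add_half_sq_le hx (hD.scale_mem_closedBall (hD.subset_closedBall hz))
  have e := hD.smul_scale_sub x z
  have e1 : D.V x z = D.R ^ 2 * D.θ (D.R⁻¹ • (z - D.x₀)) - D.R ^ 2 * D.θ (D.R⁻¹ • (x - D.x₀))
      - D.R ^ 2 * D.θ' (D.R⁻¹ • (x - D.x₀)) (D.R⁻¹ • (z - D.x₀) - D.R⁻¹ • (x - D.x₀)) := by
    unfold Data.V Data.proxy' Data.proxy
    conv_lhs => rw [e]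
    rw [smul_apply, map_smul, smul_eq_mul, smul_eq_mul]
    ring
  have e2 : ‖z - x‖ ^ 2 = D.R ^ 2 * ‖D.R⁻¹ • (z - D.x₀) - D.R⁻¹ • (x - D.x₀)‖ ^ 2 := by
    conv_lhs => rw [e]
    rw [norm_smul, mul_pow, Real.norm_eq_abs, sq_abs]
  have := mul_le_mul_of_nonneg_left h (sq_nonneg D.R)
  rw [e1, e2]
  linarith

theorem proxy_sub_le (hD : D.Assumptions P) [FiniteDimensional ℝ E] {z : E} (hz : z ∈ D.X) :
    D.proxy z - D.proxy D.x₀ ≤ D.R ^ 2 * D.Θ := by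
  have hcomp : IsCompact (D.θ '' closedBall (0 : E) 1) :=
    haveI := FiniteDimensional.proper ℝ E
    (isCompact_closedBall (0 : E) 1).image_of_continuousOn hD.proxy.continuous
  have h1 : D.θ (D.R⁻¹ • (z - D.x₀)) ≤ sSup (D.θ '' closedBall (0 : E) 1) :=
    le_csSup hcomp.bddAbove
      (mem_image_of_mem _ (hD.scale_mem_closedBall (hD.subset_closedBall hz)))
  have h2 : sInf (D.θ '' closedBall (0 : E) 1) ≤ D.θ (D.R⁻¹ • (D.x₀ - D.x₀)) :=
    csInf_le hcomp.bddBelow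
      (mem_image_of_mem _ (hD.scale_mem_closedBall (mem_closedBall_self hD.R_pos.le)))
  unfold Data.proxy Data.Θ
  rw [← mul_sub]
  exact mul_le_mul_of_nonneg_left (by linarith) (sq_nonneg _)

theorem V_x₀_le (hD : D.Assumptions P) [FiniteDimensional ℝ E] {z : E} (hz : z ∈ D.X) :
    D.V D.x₀ z ≤ D.R ^ 2 * D.Θ := by
  have : D.proxy' D.x₀ = 0 := by
    unfold Data.proxy'
    rw [sub_self, smul_zero, hD.proxy.subgradient_zero, smul_zero]
  unfold Data.V
  rw [this, zero_apply, sub_zero]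
  exact hD.proxy_sub_le hz

/-- Strong convexity compares the value at a unit vector with the value at 0. The bound lets factors
of √Θ be inserted in `balanced_stepsize_bound`. -/
theorem half_le_Θ (hD : D.Assumptions P) [FiniteDimensional ℝ E] [Nontrivial E] :
    1 / 2 ≤ D.Θ := by
  obtain ⟨e, he⟩ := exists_norm_eq E (zero_le_one' ℝ)
  have hcomp : IsCompact (D.θ '' closedBall (0 : E) 1) :=
    haveI := FiniteDimensional.proper ℝ E
    (isCompact_closedBall (0 : E) 1).image_of_continuousOn hD.proxy.continuous
  have heb : e ∈ closedBall (0 : E) 1 := by rw [mem_closedBall_zero_iff, he]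
  have h0 : (0 : E) ∈ closedBall (0 : E) 1 := mem_closedBall_self zero_le_one
  have h1 := le_csSup hcomp.bddAbove (mem_image_of_mem _ heb)
  have h2 := csInf_le hcomp.bddBelow (mem_image_of_mem _ h0)
  have h3 := hD.proxy.add_half_sq_le
    (ball_subset_proxyDom hD.proxy (mem_ball_self one_pos)) heb
  rw [hD.proxy.subgradient_zero, zero_apply, sub_zero, he] at h3
  unfold Data.Θ
  linarith

/-- X may touch the sphere, where ϑ can fail to have subgradients; minimizers avoid such points
because X contains the interior point x₀. -/
theorem mem_proxDom_of_isMinOn (hD : D.Assumptions P) {h : E → ℝ} {β : ℝ} (hβ : 0 < β)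
    (hh : ConvexOn ℝ D.X h) {y : E} (hy : y ∈ D.X)
    (hmin : ∀ z ∈ D.X, h y + β * D.proxy y ≤ h z + β * D.proxy z) : y ∈ D.proxDom := by
  obtain ⟨s, hs⟩ := subdiff_nonempty_of_isMinOn_add (hD.convexOn_proxy.smul hβ.le)
    (hD.continuousOn_proxy.const_smul β) hh hD.x₀_mem
    (interior_maximal ball_subset_closedBall isOpen_ball (mem_ball_self hD.R_pos)) hy hmin
  refine ⟨hD.scale_mem_closedBall (hD.subset_closedBall hy), (β * D.R)⁻¹ • s, fun w hw => ?_⟩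
  have hR := hD.R_pos
  have hz : D.x₀ + D.R • w ∈ closedBall D.x₀ D.R := by
    rw [mem_closedBall_zero_iff] at hw
    rw [mem_closedBall, dist_eq_norm, add_sub_cancel_left, norm_smul, Real.norm_of_nonneg hR.le]
    exact mul_le_of_le_one_right hR.le hw
  have h1 := hs _ hz
  have e : D.R⁻¹ • (D.x₀ + D.R • w - D.x₀) = w := by
    rw [add_sub_cancel_left, inv_smul_smul₀ hR.ne']
  have e2 := hD.smul_scale_sub y (D.x₀ + D.R • w)
  rw [e] at e2
  rw [e2, map_smul] at h1
  simp only [smul_eq_mul] at h1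
  unfold Data.proxy at h1
  rw [e] at h1
  rw [smul_apply, smul_eq_mul]
  set q := s (w - D.R⁻¹ • (y - D.x₀))
  have h2 : q ≤ (β * D.R) * (D.θ w - D.θ (D.R⁻¹ • (y - D.x₀))) := by
    refine le_of_mul_le_mul_left ?_ hR
    linarith
  have h3 : (β * D.R)⁻¹ * q ≤ D.θ w - D.θ (D.R⁻¹ • (y - D.x₀)) := by
    rw [inv_mul_le_iff₀ (by positivity)]; exact h2
  linarith

/-- The optimality condition for a composite minimization problem, in terms of the chosen
subgradient of the proxy function. -/
theorem optimality_of_isMinOn (hD : D.Assumptions P) {h : E → ℝ} {β : ℝ} (hβ : 0 < β)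
    (hh : ConvexOn ℝ D.X h) {y : E} (hy : y ∈ D.X)
    (hmin : ∀ z ∈ D.X, h y + β * D.proxy y ≤ h z + β * D.proxy z) {z : E} (hz : z ∈ D.X) :
    h y ≤ h z + β * D.proxy' y (z - y) := by
  have hyd := hD.mem_proxDom_of_isMinOn hβ hh hy hmin
  have hR := hD.R_pos
  -- Abstract optimality would yield some subgradient, not the selected one. Here ϑ' is evaluated at
  -- y + t(z − y), inside the ball, and continuity of the selection lets t → 0.
  have main : ∀ z ∈ D.X, z ∈ ball D.x₀ D.R → h y ≤ h z + β * D.proxy' y (z - y) := by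
    intro z hz hzb
    have hzI : z ∈ interior (closedBall D.x₀ D.R) :=
      interior_maximal ball_subset_closedBall isOpen_ball hzb
    have hlim : Tendsto (fun t : ℝ => y + t • (z - y)) (𝓝[>] 0) (𝓝[D.proxDom] y) := by
      rw [tendsto_nhdsWithin_iff]
      constructor
      · have : Tendsto (fun t : ℝ => y + t • (z - y)) (𝓝 0) (𝓝 (y + (0 : ℝ) • (z - y))) :=
          Continuous.tendsto (by fun_prop) 0
        rw [zero_smul, add_zero] at this
        exact this.mono_left nhdsWithin_le_nhds
      · filter_upwards [Ioc_mem_nhdsGT (zero_lt_one' ℝ)] with t ht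
        have := (convex_closedBall D.x₀ D.R).add_smul_sub_mem_interior
          (hD.subset_closedBall hy) hzI ht
        rw [interior_closedBall _ hR.ne'] at this
        exact hD.ball_subset_proxDom this
    have hl2 : Tendsto (fun t : ℝ => h z + β * D.proxy' (y + t • (z - y)) (z - y)) (𝓝[>] 0)
        (𝓝 (h z + β * D.proxy' y (z - y))) :=
      tendsto_const_nhds.add (tendsto_const_nhds.mul
        (((ContinuousLinearMap.apply ℝ ℝ (z - y)).continuous.tendsto _).comp
          ((hD.continuousOn_proxy' y hyd).tendsto.comp hlim)))
    refine ge_of_tendsto hl2 ?_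
    filter_upwards [Ioc_mem_nhdsGT (zero_lt_one' ℝ),
      (tendsto_nhdsWithin_iff.mp hlim).2] with t ht htd
    have h1 := hmin _ (hD.convex_X.add_smul_sub_mem hy hz ⟨ht.1.le, ht.2⟩)
    have h2 := hh.2 hy hz (sub_nonneg.mpr ht.2) ht.1.le (by ring)
    have e : (1 - t) • y + t • z = y + t • (z - y) := by module
    rw [e] at h2
    simp only [smul_eq_mul] at h2
    have h3 := hD.half_sq_le_V htd hy
    unfold Data.V at h3
    have e2 : y - (y + t • (z - y)) = -(t • (z - y)) := by module
    rw [e2, map_neg, map_smul, smul_eq_mul] at h3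
    have h4 : 0 ≤ D.proxy y - D.proxy (y + t • (z - y))
        + t * D.proxy' (y + t • (z - y)) (z - y) := by
      have := sq_nonneg ‖-(t • (z - y))‖
      linarith
    have h5 := mul_nonneg hβ.le h4
    have h6 : t * h y ≤ t * (h z + β * D.proxy' (y + t • (z - y)) (z - y)) := by linarith
    exact le_of_mul_le_mul_left h6 ht.1
  refine le_of_forall_le_combo (b := h D.x₀ + β * D.proxy' y (D.x₀ - y)) fun t ht ht1 => ?_
  have hm := hD.convex_X.add_smul_sub_mem hz hD.x₀_mem ⟨ht.le, ht1⟩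
  have hb := (convex_closedBall D.x₀ D.R).add_smul_sub_mem_interior (hD.subset_closedBall hz)
    (interior_maximal ball_subset_closedBall isOpen_ball (mem_ball_self hR)) ⟨ht, ht1⟩
  rw [interior_closedBall _ hR.ne'] at hb
  have h1 := main _ hm hb
  have h2 := hh.2 hz hD.x₀_mem (sub_nonneg.mpr ht1) ht.le (by ring)
  have e : (1 - t) • z + t • D.x₀ = z + t • (D.x₀ - z) := by module
  rw [e] at h2
  have e2 : z + t • (D.x₀ - z) - y = (1 - t) • (z - y) + t • (D.x₀ - y) := by module
  rw [e2, map_add, map_smul, map_smul] at h1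
  simp only [smul_eq_mul] at h1 h2
  linarith

section Argmin

variable {h : E → ℝ} {β : ℝ}

theorem bregmanArgmin_spec (hD : D.Assumptions P) (hh : ContinuousOn h D.X)
    (η : StrongDual ℝ E) : D.bregmanArgmin h β η ∈ D.X ∧
      IsMinOn (fun z => η z + h z + β * D.proxy z) D.X (D.bregmanArgmin h β η) := by
  refine Classical.epsilon_spec (p := fun u => u ∈ D.X ∧
    IsMinOn (fun z => η z + h z + β * D.proxy z) D.X u) ?_
  obtain ⟨u, hu, hmin⟩ := hD.compact_X.exists_isMinOn ⟨_, hD.x₀_mem⟩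
    (f := fun z => η z + h z + β * D.proxy z) (by
      refine (η.continuous.continuousOn.add hh).add
        (continuousOn_const.mul (hD.continuousOn_proxy.mono hD.subset_closedBall)))
  exact ⟨u, hu, hmin⟩

theorem convexOn_linear_add (hD : D.Assumptions P) (hh : ConvexOn ℝ D.X h)
    (η : StrongDual ℝ E) : ConvexOn ℝ D.X (fun z => η z + h z) :=
  (η.toLinearMap.convexOn hD.convex_X).add hh

variable (hβ : 0 < β) (hconv : ConvexOn ℝ D.X h) (hcont : ContinuousOn h D.X)

include hβ hconv hcont

theorem bregmanArgmin_mem_proxDom (hD : D.Assumptions P) (η : StrongDual ℝ E) :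
    D.bregmanArgmin h β η ∈ D.proxDom :=
  hD.mem_proxDom_of_isMinOn hβ (hD.convexOn_linear_add hconv η) (hD.bregmanArgmin_spec hcont η).1
    (hD.bregmanArgmin_spec hcont η).2

theorem bregmanArgmin_optimality (hD : D.Assumptions P) (η : StrongDual ℝ E) {z : E}
    (hz : z ∈ D.X) : η (D.bregmanArgmin h β η) + h (D.bregmanArgmin h β η) ≤
      η z + h z + β * D.proxy' (D.bregmanArgmin h β η) (z - D.bregmanArgmin h β η) :=
  hD.optimality_of_isMinOn hβ (hD.convexOn_linear_add hconv η) (hD.bregmanArgmin_spec hcont η).1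
    (hD.bregmanArgmin_spec hcont η).2 hz

theorem bregmanArgmin_growth (hD : D.Assumptions P) (η : StrongDual ℝ E) {z : E}
    (hz : z ∈ D.X) : η (D.bregmanArgmin h β η) + h (D.bregmanArgmin h β η)
      + β * D.proxy (D.bregmanArgmin h β η) + β * (‖z - D.bregmanArgmin h β η‖ ^ 2 / 2) ≤
      η z + h z + β * D.proxy z := by
  have h1 := hD.bregmanArgmin_optimality hβ hconv hcont η hz
  have h2 := mul_le_mul_of_nonneg_left
    (hD.half_sq_le_V (hD.bregmanArgmin_mem_proxDom hβ hconv hcont η) hz) hβ.le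
  unfold Data.V at h2
  linarith

/-- Adding the growth inequalities of two minimizers shows that the argmin is 1/β-Lipschitz in the
dual vector; measurability of the algorithm rests on this. -/
theorem continuous_bregmanArgmin (hD : D.Assumptions P) :
    Continuous (D.bregmanArgmin h β) := by
  refine (LipschitzWith.of_dist_le_mul (K := Real.toNNReal β⁻¹) fun η η' => ?_).continuous
  rw [Real.coe_toNNReal _ (inv_nonneg.mpr hβ.le), dist_eq_norm, dist_eq_norm]
  set y := D.bregmanArgmin h β η with hy
  set y' := D.bregmanArgmin h β η' with hy'
  have h1 := hD.bregmanArgmin_growth hβ hconv hcont η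
    (hD.bregmanArgmin_spec (β := β) hcont η').1
  have h2 := hD.bregmanArgmin_growth hβ hconv hcont η'
    (hD.bregmanArgmin_spec (β := β) hcont η).1
  rw [← hy, ← hy'] at h1 h2
  rw [norm_sub_rev] at h1
  have h3 : β * ‖y - y'‖ ^ 2 ≤ (η' - η) (y - y') := by
    rw [sub_apply, map_sub, map_sub]
    linarith
  have h4 : (η' - η) (y - y') ≤ ‖η' - η‖ * ‖y - y'‖ :=
    (le_abs_self _).trans ((η' - η).le_opNorm _)
  rw [norm_sub_rev η]
  rcases (norm_nonneg (y - y')).eq_or_lt with h0 | h0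
  · rw [← h0]; positivity
  · rw [← div_eq_inv_mul, le_div_iff₀ hβ]
    refine le_of_mul_le_mul_right ?_ h0
    linarith

end Argmin

section Prox

variable {β : ℝ}

theorem prox_mem (hD : D.Assumptions P) (x : E) (ξ : StrongDual ℝ E) :
    D.prox β x ξ ∈ D.X := by
  rw [prox_eq_bregmanArgmin]
  exact (hD.bregmanArgmin_spec hD.continuous_ψ _).1

theorem prox_mem_proxDom (hD : D.Assumptions P) (hβ : 0 < β) (x : E)
    (ξ : StrongDual ℝ E) : D.prox β x ξ ∈ D.proxDom := by
  rw [prox_eq_bregmanArgmin]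
  exact hD.bregmanArgmin_mem_proxDom hβ hD.convex_ψ hD.continuous_ψ _

theorem prox_three_point (hD : D.Assumptions P) (hβ : 0 < β) (x : E) (ξ : StrongDual ℝ E)
    {z : E} (hz : z ∈ D.X) :
    ξ (D.prox β x ξ - z) + D.ψ (D.prox β x ξ) - D.ψ z ≤
      β * (D.V x z - D.V (D.prox β x ξ) z - D.V x (D.prox β x ξ)) := by
  have h1 := hD.bregmanArgmin_optimality hβ hD.convex_ψ hD.continuous_ψ (ξ - β • D.proxy' x) hz
  rw [← prox_eq_bregmanArgmin] at h1
  simp only [Data.V, sub_apply, smul_apply, map_sub, smul_eq_mul] at h1 ⊢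
  linarith

/-- One step of mirror descent with an inexact gradient. -/
theorem prox_step (hD : D.Assumptions P) (hβ : 0 < β) {x : E} (hx : x ∈ D.proxDom)
    (y g : StrongDual ℝ E) {z : E} (hz : z ∈ D.X) :
    β⁻¹ * (g (D.prox β x y - z) + D.ψ (D.prox β x y) - D.ψ z) + 1 / 2 * D.V x (D.prox β x y) ≤
      D.V x z - D.V (D.prox β x y) z
        + (β⁻¹ * (y - g) (z - x) + β⁻¹ ^ 2 * ‖y - g‖ ^ 2) := by
  set u := D.prox β x y with hu
  have h1 := hD.prox_three_point hβ x y hz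
  rw [← hu] at h1
  have h2 := hD.half_sq_le_V hx (hD.prox_mem (β := β) x y)
  rw [← hu] at h2
  have h3 : -(y - g) (u - x) ≤ ‖y - g‖ * ‖u - x‖ :=
    (neg_le_abs _).trans ((y - g).le_opNorm _)
  have hb : 0 < β⁻¹ := inv_pos.mpr hβ
  have h4 := mul_le_mul_of_nonneg_left h1 hb.le
  rw [inv_mul_cancel_left₀ hβ.ne'] at h4
  have h5 := mul_le_mul_of_nonneg_left h3 hb.le
  -- The quarter square is at most V_x(u)/2, the part of −V_x(u) not used by the left-hand side.
  have h6 : β⁻¹ * (‖y - g‖ * ‖u - x‖) ≤ β⁻¹ ^ 2 * ‖y - g‖ ^ 2 + ‖u - x‖ ^ 2 / 4 := by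
    nlinarith [sq_nonneg (β⁻¹ * ‖y - g‖ - ‖u - x‖ / 2)]
  have h7 : β⁻¹ * (g (u - z)) = β⁻¹ * (y (u - z)) + β⁻¹ * (y - g) (z - x)
      + β⁻¹ * (-(y - g) (u - x)) := by
    simp only [sub_apply, map_sub]; ring
  linarith

end Prox

/-- One step of dual averaging. -/
theorem dual_averaging_step (hD : D.Assumptions P) (a δ : StrongDual ℝ E) :
    a (D.bregmanArgmin 0 1 a) + D.proxy (D.bregmanArgmin 0 1 a)
        - δ (D.bregmanArgmin 0 1 a) - ‖δ‖ ^ 2 / 2 ≤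
      (a - δ) (D.bregmanArgmin 0 1 (a - δ)) + D.proxy (D.bregmanArgmin 0 1 (a - δ)) := by
  have hc : ConvexOn ℝ D.X (0 : E → ℝ) := convexOn_const 0 hD.convex_X
  have hc' : ContinuousOn (0 : E → ℝ) D.X := continuousOn_const
  set z := D.bregmanArgmin 0 1 a with hz
  set z' := D.bregmanArgmin 0 1 (a - δ) with hz'
  have h1 := hD.bregmanArgmin_growth one_pos hc hc' a
    (hD.bregmanArgmin_spec (β := 1) hc' (a - δ)).1
  rw [← hz, ← hz'] at h1
  have h2 : δ (z' - z) ≤ ‖δ‖ * ‖z' - z‖ := (le_abs_self _).trans (δ.le_opNorm _)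
  have h3 : ‖δ‖ * ‖z' - z‖ ≤ ‖δ‖ ^ 2 / 2 + ‖z' - z‖ ^ 2 / 2 := by
    nlinarith [sq_nonneg (‖δ‖ - ‖z' - z‖)]
  simp only [Pi.zero_apply, one_mul, add_zero, sub_apply, map_sub] at h1 h2 ⊢
  linarith

end Assumptions

end Data

end RSMD

end

noncomputable section

namespace RSMD

open Filter Topology

universe u v

/-! ### Exponential moments of sums along a driven system -/

section Chain

variable {S : Type u} {Ω : Type v}

/-- The states of a system driven by the inputs `ω`. -/
def chain (f : S → Ω → S) {N : ℕ} (s : S) (ω : Fin N → Ω) : ℕ → S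
  | 0 => s
  | i + 1 => if h : i < N then f (chain f s ω i) (ω ⟨i, h⟩) else chain f s ω i

theorem chain_succ_of_lt (f : S → Ω → S) {N : ℕ} (s : S) (ω : Fin N → Ω) (i : Fin N) :
    chain f s ω (i + 1) = f (chain f s ω i) (ω i) := by
  rw [chain, dif_pos i.2]

theorem chain_cons (f : S → Ω → S) {N : ℕ} (s : S) (w : Ω) (ω : Fin N → Ω) (i : ℕ) :
    chain f s (Fin.cons w ω : Fin (N + 1) → Ω) (i + 1) = chain f (f s w) ω i := by
  induction i with
  | zero => simp [chain]
  | succ i ih =>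
    rw [chain, ih]
    conv_rhs => rw [chain]
    by_cases h : i < N
    · rw [dif_pos h, dif_pos (Nat.succ_lt_succ h)]; rfl
    · rw [dif_neg h, dif_neg (fun h' => h (Nat.lt_of_succ_lt_succ h'))]

variable [MeasurableSpace S] [MeasurableSpace Ω]

theorem measurable_chain {f : S → Ω → S} (hf : Measurable fun p : S × Ω => f p.1 p.2) {N : ℕ}
    (s : S) (i : ℕ) : Measurable fun ω : Fin N → Ω => chain f s ω i := by
  induction i with
  | zero => exact measurable_const
  | succ i ih =>
    by_cases h : i < N
    · simp only [chain, dif_pos h]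
      exact hf.comp (ih.prodMk (measurable_pi_apply _))
    · simpa only [chain, dif_neg h] using ih

theorem measurable_sum_chain {f : S → Ω → S} {u : S → Ω → ℝ}
    (hf : Measurable fun p : S × Ω => f p.1 p.2) (hu : Measurable fun p : S × Ω => u p.1 p.2)
    (N : ℕ) (s : S) :
    Measurable fun ω : Fin N → Ω => ∑ i : Fin N, u (chain f s ω i) (ω i) :=
  Finset.measurable_sum _ fun i _ =>
    hu.comp ((measurable_chain hf s i).prodMk (measurable_pi_apply i))

/-- If the exponential moment of each increment, conditionally on the current state, is at most
`K`, then the exponential moment of the sum of `N` increments is at most `K ^ N`. -/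
theorem lintegral_exp_sum_chain_le {P : Measure Ω} [IsProbabilityMeasure P] {f : S → Ω → S}
    {u : S → Ω → ℝ} {K : ENNReal} (hf : Measurable fun p : S × Ω => f p.1 p.2)
    (hu : Measurable fun p : S × Ω => u p.1 p.2)
    (hK : ∀ s, ∫⁻ w, ENNReal.ofReal (Real.exp (u s w)) ∂P ≤ K) (N : ℕ) (s : S) :
    ∫⁻ ω, ENNReal.ofReal (Real.exp (∑ i : Fin N, u (chain f s ω i) (ω i)))
      ∂(Measure.pi fun _ : Fin N => P) ≤ K ^ N := by
  -- The first input is split off: the remaining sum is the same functional started at f s w, so the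
  -- induction hypothesis is needed for every initial state.
  induction N generalizing s with
  | zero => simp
  | succ n ih =>
    have hF : Measurable fun ω : Fin (n + 1) → Ω =>
        ENNReal.ofReal (Real.exp (∑ i : Fin (n + 1), u (chain f s ω i) (ω i))) :=
      (Real.measurable_exp.comp (measurable_sum_chain hf hu (n + 1) s)).ennreal_ofReal
    have hmp := (measurePreserving_piFinSuccAbove (fun _ : Fin (n + 1) => P) 0).symm
    rw [← hmp.lintegral_comp hF]
    refine (lintegral_prod _ (hF.comp hmp.measurable).aemeasurable).trans_le ?_
    simp only [Function.comp_apply]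
    have e : ∀ (w : Ω) (r : Fin n → Ω), ENNReal.ofReal (Real.exp (∑ i : Fin (n + 1),
        u (chain f s ((MeasurableEquiv.piFinSuccAbove (fun _ : Fin (n + 1) => Ω) 0).symm (w, r)) i)
          ((MeasurableEquiv.piFinSuccAbove (fun _ : Fin (n + 1) => Ω) 0).symm (w, r) i)))
        = ENNReal.ofReal (Real.exp (u s w)) *
          ENNReal.ofReal (Real.exp (∑ i : Fin n, u (chain f (f s w) r i) (r i))) := by
      intro w r
      have e1 : (MeasurableEquiv.piFinSuccAbove (fun _ : Fin (n + 1) => Ω) 0).symm (w, r)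
          = (Fin.cons w r : Fin (n + 1) → Ω) := by
        simp only [MeasurableEquiv.piFinSuccAbove, Fin.insertNthEquiv_zero]
        rfl
      rw [e1, Fin.sum_univ_succ, Real.exp_add, ENNReal.ofReal_mul (Real.exp_pos _).le]
      simp only [Fin.val_zero, Fin.val_succ, chain_cons, Fin.cons_zero, Fin.cons_succ, chain]
    simp only [e]
    calc ∫⁻ w, ∫⁻ r, ENNReal.ofReal (Real.exp (u s w)) *
          ENNReal.ofReal (Real.exp (∑ i : Fin n, u (chain f (f s w) r i) (r i)))
            ∂(Measure.pi fun _ : Fin n => P) ∂P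
        ≤ ∫⁻ w, ENNReal.ofReal (Real.exp (u s w)) * K ^ n ∂P := by
          refine lintegral_mono fun w => ?_
          rw [lintegral_const_mul' _ _ ENNReal.ofReal_ne_top]
          exact mul_le_mul_right (ih (f s w)) _
      _ = (∫⁻ w, ENNReal.ofReal (Real.exp (u s w)) ∂P) * K ^ n := by
          refine lintegral_mul_const _ ?_
          exact (Real.measurable_exp.comp
            (hu.comp (measurable_const.prodMk measurable_id))).ennreal_ofReal
      _ ≤ K ^ (n + 1) := by
          rw [pow_succ, mul_comm (K ^ n)]
          exact mul_le_mul_left (hK s) _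

/-- Exponential Markov inequality for the sum of the increments. -/
theorem le_measureReal_sum_chain_le {P : Measure Ω} [IsProbabilityMeasure P] {f : S → Ω → S}
    {u : S → Ω → ℝ} (hf : Measurable fun p : S × Ω => f p.1 p.2)
    (hu : Measurable fun p : S × Ω => u p.1 p.2) {N : ℕ} (hN : 1 ≤ N)
    (hK : ∀ s, ∫⁻ w, ENNReal.ofReal (Real.exp (u s w)) ∂P ≤ ENNReal.ofReal (Real.exp (1 / N)))
    (s : S) (τ : ℝ) :
    1 - Real.exp (-τ) ≤ (Measure.pi fun _ : Fin N => P).real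
      {ω | ∑ i : Fin N, u (chain f s ω i) (ω i) ≤ 1 + τ} := by
  set Q := Measure.pi fun _ : Fin N => P
  set Y : (Fin N → Ω) → ℝ := fun ω => ∑ i : Fin N, u (chain f s ω i) (ω i) with hY
  have hYm : Measurable Y := measurable_sum_chain hf hu N s
  have hint : ∫⁻ ω, ENNReal.ofReal (Real.exp (Y ω)) ∂Q ≤ ENNReal.ofReal (Real.exp 1) := by
    refine (lintegral_exp_sum_chain_le hf hu hK N s).trans_eq ?_
    rw [← ENNReal.ofReal_pow (Real.exp_pos _).le, ← Real.exp_nat_mul]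
    have : (N : ℝ) * (1 / N) = 1 := mul_one_div_cancel (by positivity)
    rw [this]
  have hmarkov := meas_ge_le_lintegral_div (μ := Q)
    (Real.measurable_exp.comp hYm).ennreal_ofReal.aemeasurable
    (ε := ENNReal.ofReal (Real.exp (1 + τ)))
    (by simpa using Real.exp_pos _) ENNReal.ofReal_ne_top
  have hA : MeasurableSet {ω | Y ω ≤ 1 + τ} := measurableSet_le hYm measurable_const
  have hsub : Q {ω | Y ω ≤ 1 + τ}ᶜ ≤ ENNReal.ofReal (Real.exp (-τ)) := by
    calc Q {ω | Y ω ≤ 1 + τ}ᶜ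
        ≤ Q {ω | ENNReal.ofReal (Real.exp (1 + τ)) ≤ ENNReal.ofReal (Real.exp (Y ω))} := by
          refine measure_mono fun ω hω => ?_
          have : 1 + τ < Y ω := not_le.mp hω
          exact ENNReal.ofReal_le_ofReal (Real.exp_le_exp.mpr this.le)
      _ ≤ ENNReal.ofReal (Real.exp 1) / ENNReal.ofReal (Real.exp (1 + τ)) :=
          hmarkov.trans (ENNReal.div_le_div_right hint _)
      _ = ENNReal.ofReal (Real.exp (-τ)) := by
          rw [← ENNReal.ofReal_div_of_pos (Real.exp_pos _), ← Real.exp_sub]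
          congr 2
          ring
  have h1 : Q.real {ω | Y ω ≤ 1 + τ}ᶜ ≤ Real.exp (-τ) :=
    ENNReal.toReal_le_of_le_ofReal (Real.exp_pos _).le hsub
  have h2 := probReal_compl_eq_one_sub (μ := Q) hA
  linarith

end Chain

/-! ### Pathwise error bound through the ghost sequence -/

namespace Data

variable {E : Type u} [NormedAddCommGroup E] [NormedSpace ℝ E] {Ω : Type v}

/-- The error of the truncated gradient. -/
def noise (D : Data E Ω) (lam : ℝ) (x : E) (w : Ω) : StrongDual ℝ E :=
  D.truncGrad lam x w - D.gradφ x

/-- The states of the algorithm augmented by an auxiliary dual averaging sequence. -/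
abbrev State (D : Data E Ω) : Type u := {x : E // x ∈ D.X ∧ x ∈ D.proxDom} × StrongDual ℝ E

/-- The contribution of one step to the bound for the error. -/
def increment (D : Data E Ω) (β lam : ℝ) (s : D.State) (w : Ω) : ℝ :=
  β⁻¹ * D.noise lam s.1 w (D.bregmanArgmin 0 1 s.2 - s.1)
    + 3 / 2 * (β⁻¹ ^ 2 * ‖D.noise lam s.1 w‖ ^ 2)

namespace Assumptions

variable [MeasurableSpace E] [MeasurableSpace Ω] {D : Data E Ω} {P : Measure Ω}

/-- One step of the algorithm together with the auxiliary dual averaging sequence. -/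
def step (hD : D.Assumptions P) {β : ℝ} (hβ : 0 < β) (lam : ℝ) (s : D.State) (w : Ω) : D.State :=
  (⟨D.prox β s.1 (D.truncGrad lam s.1 w), hD.prox_mem _ _, hD.prox_mem_proxDom hβ _ _⟩,
    s.2 - β⁻¹ • D.noise lam s.1 w)

/-- The initial state. -/
def initialState (hD : D.Assumptions P) : D.State := (⟨D.x₀, hD.x₀_mem, hD.x₀_mem_proxDom⟩, 0)

theorem iter_eq_chain (hD : D.Assumptions P) {β : ℝ} (hβ : 0 < β) (lam : ℝ) {N : ℕ}
    (ω : Fin N → Ω) (i : ℕ) :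
    D.iter (fun _ => β) lam ω i = (chain (hD.step hβ lam) hD.initialState ω i).1 := by
  induction i with
  | zero => rfl
  | succ i ih =>
    rw [iter, chain]
    split_ifs with h
    · rw [ih]; rfl
    · exact ih

theorem proxy_x₀_le (hD : D.Assumptions P) {z : E} (hz : z ∈ D.X) : D.proxy D.x₀ ≤ D.proxy z := by
  unfold Data.proxy
  rw [sub_self, smul_zero]
  exact mul_le_mul_of_nonneg_left
    (hD.proxy.min_zero (hD.scale_mem_closedBall (hD.subset_closedBall hz))) (sq_nonneg _)

theorem eps_le (hD : D.Assumptions P) [FiniteDimensional ℝ E] {β : ℝ} (hβ : 0 < β) (lam : ℝ)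
    {N : ℕ} (ω : Fin N → Ω) {z : E} (hz : z ∈ D.X) :
    D.eps (fun _ => β) N (D.iter (fun _ => β) lam ω) z ≤ 2 * (D.R ^ 2 * D.Θ)
      + ∑ i : Fin N, D.increment β lam (chain (hD.step hβ lam) hD.initialState ω i) (ω i) := by
  let c := chain (hD.step hβ lam) hD.initialState ω
  -- Potential: Bregman distance to z plus the suboptimality of z in the ghost problem, without the
  -- term ϑ(z). In `increment`, 3/2 is 1 from `prox_step` plus 1/2 from `dual_averaging_step`.
  let T : ℕ → ℝ := fun k => D.V (c k).1 z + (c k).2 z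
    - ((c k).2 (D.bregmanArgmin 0 1 (c k).2) + D.proxy (D.bregmanArgmin 0 1 (c k).2))
  have hc0 : ConvexOn ℝ D.X (0 : E → ℝ) := convexOn_const 0 hD.convex_X
  have hc0' : ContinuousOn (0 : E → ℝ) D.X := continuousOn_const
  have key : ∀ i : Fin N,
      β⁻¹ * (D.gradφ (c i).1 ((c (i + 1)).1 - z) + D.ψ (c (i + 1)).1 - D.ψ z)
        + 1 / 2 * D.V (c i).1 (c (i + 1)).1
      ≤ (T i - T (i + 1)) + D.increment β lam (c i) (ω i) := by
    intro i
    have hcs : c (i + 1) = hD.step hβ lam (c i) (ω i) := chain_succ_of_lt _ _ _ _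
    simp only [T, hcs]
    set s := c i
    have h1 := hD.prox_step hβ s.1.2.2 (D.truncGrad lam s.1 (ω i)) (D.gradφ s.1) hz
    have h2 := hD.dual_averaging_step s.2 (β⁻¹ • D.noise lam s.1 (ω i))
    rw [norm_smul, Real.norm_of_nonneg (inv_nonneg.mpr hβ.le), mul_pow] at h2
    change β⁻¹ * (D.gradφ s.1 (D.prox β s.1 (D.truncGrad lam s.1 (ω i)) - z)
      + D.ψ (D.prox β s.1 (D.truncGrad lam s.1 (ω i))) - D.ψ z)
      + 1 / 2 * D.V s.1 (D.prox β s.1 (D.truncGrad lam s.1 (ω i))) ≤ _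
    refine h1.trans ?_
    change _ ≤ _ - (D.V (D.prox β s.1 (D.truncGrad lam s.1 (ω i))) z
      + (s.2 - β⁻¹ • D.noise lam s.1 (ω i)) z
      - ((s.2 - β⁻¹ • D.noise lam s.1 (ω i))
          (D.bregmanArgmin 0 1 (s.2 - β⁻¹ • D.noise lam s.1 (ω i)))
        + D.proxy (D.bregmanArgmin 0 1 (s.2 - β⁻¹ • D.noise lam s.1 (ω i))))) + _
    unfold increment
    rw [← noise] at *
    have e1 : (s.2 - β⁻¹ • D.noise lam s.1 (ω i)) z
        = s.2 z - β⁻¹ * D.noise lam s.1 (ω i) z := by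
      rw [sub_apply, smul_apply, smul_eq_mul]
    rw [e1]
    rw [smul_apply, smul_eq_mul] at h2
    rw [map_sub, map_sub]
    linarith
  have hsum := Finset.sum_le_sum fun i (_ : i ∈ (Finset.univ : Finset (Fin N))) => key i
  rw [Finset.sum_add_distrib (f := fun i : Fin N => T i - T (i + 1)),
    ← Finset.sum_range (fun i => T i - T (i + 1)), Finset.sum_range_sub', ← Finset.sum_range (fun i : ℕ =>
      β⁻¹ * (D.gradφ (c i).1 ((c (i + 1)).1 - z) + D.ψ (c (i + 1)).1 - D.ψ z)
        + 1 / 2 * D.V (c i).1 (c (i + 1)).1)] at hsum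
  have he : D.eps (fun _ => β) N (D.iter (fun _ => β) lam ω) z
      = ∑ i ∈ Finset.range N,
        (β⁻¹ * (D.gradφ (c i).1 ((c (i + 1)).1 - z) + D.ψ (c (i + 1)).1 - D.ψ z)
        + 1 / 2 * D.V (c i).1 (c (i + 1)).1) := by
    unfold eps
    simp only [hD.iter_eq_chain hβ]
    rfl
  rw [he]
  have hT0 : T 0 ≤ D.R ^ 2 * D.Θ - D.proxy D.x₀ := by
    have e : T 0 = D.V D.x₀ z + 0 - (0 + D.proxy (D.bregmanArgmin 0 1 0)) := rfl
    rw [e]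
    have := hD.proxy_x₀_le (hD.bregmanArgmin_spec (β := 1) hc0' 0).1
    linarith [hD.V_x₀_le hz]
  have hTN : - D.proxy z ≤ T N := by
    have h1 := hD.bregmanArgmin_growth one_pos hc0 hc0' (c N).2 hz
    have h2 := hD.half_sq_le_V (c N).1.2.2 hz
    have h3 := sq_nonneg ‖z - (c N).1‖
    have h4 := sq_nonneg ‖z - D.bregmanArgmin 0 1 (c N).2‖
    simp only [Pi.zero_apply, one_mul, add_zero] at h1
    simp only [T]
    linarith
  have := hD.proxy_sub_le hz
  linarith

/-! ### Deterministic bounds for the truncated noise -/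

section Noise

variable {K lam : ℝ}

theorem norm_gbar_sub_gradφ_le (hD : D.Assumptions P) {x : E} (hx : x ∈ D.X) :
    ‖D.gbar - D.gradφ x‖ ≤ D.υ * D.σ + D.L * ‖D.xbar - x‖ := by
  have h1 := hD.gbar_close
  have h2 := hD.lipschitz_grad x hx _ hD.xbar_mem
  rw [norm_sub_rev x] at h2
  have := norm_sub_le_norm_sub_add_norm_sub D.gbar (D.gradφ D.xbar) (D.gradφ x)
  linarith

theorem norm_sub_le_two_mul (hD : D.Assumptions P) {x z : E} (hx : x ∈ D.X) (hz : z ∈ D.X) :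
    ‖x - z‖ ≤ 2 * D.R := by
  have := norm_sub_le_norm_sub_add_norm_sub x D.x₀ z
  rw [norm_sub_rev D.x₀] at this
  linarith [hD.dist_le x hx, hD.dist_le z hz]

theorem noise_cases (hD : D.Assumptions P) {x : E} (hx : x ∈ D.X) (w : Ω) :
    (D.noise lam x w = D.G x w - D.gradφ x ∧
        ‖D.noise lam x w‖ ≤ 2 * (D.L * ‖D.xbar - x‖) + lam + 2 * (D.υ * D.σ)) ∨
      (‖D.noise lam x w‖ ≤ D.υ * D.σ + D.L * ‖D.xbar - x‖ ∧
        lam ≤ ‖D.G x w - D.gradφ x‖) := by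
  have h1 := hD.norm_gbar_sub_gradφ_le hx
  have h2 := norm_sub_le_norm_sub_add_norm_sub (D.G x w) D.gbar (D.gradφ x)
  have h3 := norm_sub_le_norm_sub_add_norm_sub (D.G x w) (D.gradφ x) D.gbar
  rw [norm_sub_rev (D.gradφ x)] at h3
  unfold noise truncGrad
  split_ifs with h
  · exact Or.inl ⟨rfl, by linarith⟩
  · push Not at h
    exact Or.inr ⟨h1, by linarith⟩

variable (hMK : D.M ≤ K) (hlam : lam = K + D.υ * D.σ)

include hMK hlam

theorem norm_noise_le_two_mul (hD : D.Assumptions P) {x : E} (hx : x ∈ D.X) (w : Ω) :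
    ‖D.noise lam x w‖ ≤ 2 * ‖D.G x w - D.gradφ x‖ := by
  have h1 := mul_le_mul_of_nonneg_left (hD.norm_sub_le_two_mul hD.xbar_mem hx) hD.L_nonneg
  have h2 := mul_nonneg hD.υ_nonneg hD.σ_pos.le
  unfold M at hMK
  rcases hD.noise_cases (lam := lam) hx w with h | h
  · rw [h.1]; linarith [norm_nonneg (D.G x w - D.gradφ x)]
  · linarith [h.1]

/-- Truncation bias: it is nonzero only on rejection, where ‖ξ − ζ‖ ≤ 3‖ζ‖ and ‖ζ‖ ≥ `lam` ≥ K turns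
one factor ‖ζ‖ into ‖ζ‖²/K, of controlled expectation. -/
theorem noise_apply_le (hD : D.Assumptions P) (hK : 0 < K) {x : E} (hx : x ∈ D.X) (w : Ω)
    (v : E) : D.noise lam x w v ≤
      (D.G x w - D.gradφ x) v + 3 * (‖D.G x w - D.gradφ x‖ ^ 2 / K) * ‖v‖ := by
  have h2 := mul_nonneg hD.υ_nonneg hD.σ_pos.le
  set ζ := D.G x w - D.gradφ x with hζ
  have h3 := hD.norm_noise_le_two_mul hMK hlam hx w
  rw [← hζ] at h3
  rcases hD.noise_cases (lam := lam) hx w with h | h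
  · rw [h.1]
    have : 0 ≤ 3 * (‖ζ‖ ^ 2 / K) * ‖v‖ := by positivity
    linarith
  · rw [← hζ] at h
    have h4 : (D.noise lam x w - ζ) v ≤ ‖D.noise lam x w - ζ‖ * ‖v‖ :=
      (le_abs_self _).trans ((D.noise lam x w - ζ).le_opNorm v)
    have h5 := norm_sub_le (D.noise lam x w) ζ
    have h6 : ‖ζ‖ ≤ ‖ζ‖ ^ 2 / K := by
      rw [le_div_iff₀ hK, sq]
      exact mul_le_mul_of_nonneg_left (by linarith [h.2]) (norm_nonneg _)
    have h7 : ‖D.noise lam x w - ζ‖ * ‖v‖ ≤ 3 * (‖ζ‖ ^ 2 / K) * ‖v‖ :=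
      mul_le_mul_of_nonneg_right (by linarith) (norm_nonneg _)
    rw [sub_apply] at h4
    linarith

theorem norm_noise_le (hυK : D.υ * D.σ ≤ K) (hD : D.Assumptions P) {x : E} (hx : x ∈ D.X) (w : Ω) :
    ‖D.noise lam x w‖ ≤ 8 * K := by
  have h1 := mul_le_mul_of_nonneg_left (hD.norm_sub_le_two_mul hD.xbar_mem hx) hD.L_nonneg
  have h2 := mul_nonneg hD.υ_nonneg hD.σ_pos.le
  unfold M at hMK
  rcases hD.noise_cases (lam := lam) hx w with h | h
  · linarith [h.2]
  · linarith [h.1]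

end Noise

end Assumptions

end Data

end RSMD

end

noncomputable section

namespace RSMD

open Filter Topology

universe u v

namespace Data.Assumptions

variable {E : Type u} [NormedAddCommGroup E] [NormedSpace ℝ E] {Ω : Type v}
  [MeasurableSpace E] [MeasurableSpace Ω] {D : Data E Ω} {P : Measure Ω}

theorem continuousOn_gradφ (hD : D.Assumptions P) : ContinuousOn D.gradφ D.X := by
  refine (LipschitzOnWith.of_dist_le_mul (K := Real.toNNReal D.L) fun x hx z hz => ?_).continuousOn
  rw [Real.coe_toNNReal _ hD.L_nonneg, dist_eq_norm, dist_eq_norm, norm_sub_rev x]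
  exact hD.lipschitz_grad z hz x hx

/-! ### Measurability of the augmented chain -/

section Measurability

variable [BorelSpace E]

theorem measurable_truncGrad (hD : D.Assumptions P) (lam : ℝ) :
    Measurable fun p : D.State × Ω => D.truncGrad lam p.1.1 p.2 := by
  have hG : Measurable fun p : D.State × Ω => D.G p.1.1 p.2 :=
    hD.measurable_G.comp (f := fun p : D.State × Ω => ((⟨p.1.1, p.1.1.2.1⟩ : D.X), p.2))
      ((Measurable.subtype_mk (by fun_prop)).prodMk measurable_snd)
  have hx : Measurable fun p : D.State × Ω => (p.1.1 : E) := by fun_prop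
  unfold truncGrad
  exact Measurable.ite (measurableSet_le (by fun_prop) (by fun_prop)) hG measurable_const

variable [FiniteDimensional ℝ E]

theorem measurable_noise (hD : D.Assumptions P) (lam : ℝ) :
    Measurable fun p : D.State × Ω => D.noise lam p.1.1 p.2 := by
  have := FiniteDimensional.proper ℝ E
  have := FiniteDimensional.proper ℝ (StrongDual ℝ E)
  have h1 : Continuous fun x : {x : E // x ∈ D.X ∧ x ∈ D.proxDom} => D.gradφ x :=
    hD.continuousOn_gradφ.comp_continuous continuous_subtype_val fun x => x.2.1
  exact (hD.measurable_truncGrad lam).sub (h1.measurable.comp (by fun_prop))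

/-- The subtype in `State` matters here: ∇φ is known to be continuous only on X, and ϑ' only on
`proxDom`. -/
theorem measurable_step (hD : D.Assumptions P) {β : ℝ} (hβ : 0 < β) (lam : ℝ) :
    Measurable fun p : D.State × Ω => hD.step hβ lam p.1 p.2 := by
  have := FiniteDimensional.proper ℝ E
  have := FiniteDimensional.proper ℝ (StrongDual ℝ E)
  have h1 : Continuous fun x : {x : E // x ∈ D.X ∧ x ∈ D.proxDom} => D.proxy' x :=
    hD.continuousOn_proxy'.comp_continuous continuous_subtype_val fun x => x.2.2
  have h2 : Measurable fun p : D.State × Ω => D.proxy' p.1.1 := h1.measurable.comp (by fun_prop)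
  refine Measurable.prodMk (Measurable.subtype_mk ?_) ?_
  · simp only [prox_eq_bregmanArgmin]
    exact (hD.continuous_bregmanArgmin hβ hD.convex_ψ hD.continuous_ψ).measurable.comp
      ((hD.measurable_truncGrad lam).sub (h2.const_smul β))
  · exact (measurable_snd.comp measurable_fst).sub ((hD.measurable_noise lam).const_smul β⁻¹)

theorem measurable_increment (hD : D.Assumptions P) (β lam : ℝ) :
    Measurable fun p : D.State × Ω => D.increment β lam p.1 p.2 := by
  have := FiniteDimensional.proper ℝ E
  have := FiniteDimensional.proper ℝ (StrongDual ℝ E)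
  have hn := hD.measurable_noise lam
  have hz : Measurable fun p : D.State × Ω => D.bregmanArgmin 0 1 p.1.2 - (p.1.1 : E) :=
    ((hD.continuous_bregmanArgmin one_pos (convexOn_const 0 hD.convex_X)
      continuousOn_const).measurable.comp (by fun_prop)).sub (by fun_prop)
  have ha : Measurable fun p : D.State × Ω =>
      D.noise lam p.1.1 p.2 (D.bregmanArgmin 0 1 p.1.2 - p.1.1) :=
    (isBoundedBilinearMap_apply (𝕜 := ℝ) (E := E) (F := ℝ)).continuous.measurable.comp
      (hn.prodMk hz)
  unfold increment
  exact (ha.const_mul _).add (((hn.norm.pow_const 2).const_mul _).const_mul _)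

end Measurability

/-! ### Exponential moment of one increment -/

/-- A bound for the exponential of a normalized increment. -/
theorem exp_increment_div_le (hD : D.Assumptions P) {β K lam : ℝ} (hβ : 0 < β) (hK : 0 < K)
    (hMK : D.M ≤ K) (hυK : D.υ * D.σ ≤ K) (hlam : lam = K + D.υ * D.σ) (s : D.State) (w : Ω) :
    Real.exp (D.increment β lam s w / (16 * K * D.R * β⁻¹ + 96 * K ^ 2 * β⁻¹ ^ 2)) ≤
      1 + β⁻¹ / (16 * K * D.R * β⁻¹ + 96 * K ^ 2 * β⁻¹ ^ 2) *
          (D.G s.1 w - D.gradφ s.1) (D.bregmanArgmin 0 1 s.2 - s.1)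
        + (K ^ 2)⁻¹ * ‖D.G s.1 w - D.gradφ s.1‖ ^ 2 := by
  have hR := hD.R_pos
  have hx : (s.1 : E) ∈ D.X := s.1.2.1
  have hv := hD.norm_sub_le_two_mul
    (hD.bregmanArgmin_spec (h := 0) (β := 1) continuousOn_const s.2).1 hx
  have h1 := hD.norm_noise_le hMK hlam hυK hx w
  have h2 := hD.norm_noise_le_two_mul hMK hlam hx w
  have h3 := hD.noise_apply_le hMK hlam hK hx w (D.bregmanArgmin 0 1 s.2 - s.1)
  have h4 := (D.noise lam s.1 w).le_opNorm (D.bregmanArgmin 0 1 s.2 - s.1)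
  unfold increment
  set v := D.bregmanArgmin 0 1 s.2 - s.1
  set ξ := D.noise lam s.1 w
  set ζ := D.G s.1 w - D.gradφ s.1
  have hb : 0 < β⁻¹ := inv_pos.mpr hβ
  set b := β⁻¹
  set q := 16 * K * D.R * b + 96 * K ^ 2 * b ^ 2 with hq
  have hqpos : 0 < q := by positivity
  set y := ‖ζ‖ / K with hy
  have hyn : 0 ≤ y := by positivity
  have hζ : ‖ζ‖ = K * y := by rw [hy]; field_simp
  have hKy : ‖ζ‖ ^ 2 / K = K * y ^ 2 := by rw [hζ]; field_simp
  have hKy2 : (K ^ 2)⁻¹ * ‖ζ‖ ^ 2 = y ^ 2 := by rw [hζ]; field_simp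
  rw [hKy2]
  rw [hKy] at h3
  rw [hζ] at h2
  rw [Real.norm_eq_abs] at h4
  have hξ0 := norm_nonneg ξ
  have hv0 := norm_nonneg v
  set r := (b * ξ v + 3 / 2 * (b ^ 2 * ‖ξ‖ ^ 2)) / q with hr
  have hrq : r * q = b * ξ v + 3 / 2 * (b ^ 2 * ‖ξ‖ ^ 2) := by
    rw [hr, div_mul_cancel₀ _ hqpos.ne']
  have hlin1 : |ξ v| ≤ 16 * K * D.R := by
    have := mul_le_mul h1 hv hv0 (by positivity)
    linarith
  have hlin2 : |ξ v| ≤ 4 * K * D.R * y := by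
    have := mul_le_mul h2 hv hv0 (by positivity)
    linarith
  have hsq1 : ‖ξ‖ ^ 2 ≤ 64 * K ^ 2 := by
    have := mul_le_mul h1 h1 hξ0 (by positivity)
    linarith
  have hsq2 : ‖ξ‖ ^ 2 ≤ 16 * K ^ 2 * y := by
    have := mul_le_mul h1 h2 hξ0 (by positivity)
    linarith
  have hsq3 : ‖ξ‖ ^ 2 ≤ 4 * K ^ 2 * y ^ 2 := by
    have := mul_le_mul h2 h2 hξ0 (by positivity)
    linarith
  have habs : |r * q| ≤ b * |ξ v| + 3 / 2 * (b ^ 2 * ‖ξ‖ ^ 2) := by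
    rw [hrq]
    refine (abs_add_le _ _).trans_eq ?_
    rw [abs_mul, abs_of_pos hb, abs_of_nonneg (a := 3 / 2 * (b ^ 2 * ‖ξ‖ ^ 2)) (by positivity)]
  rw [abs_mul, abs_of_pos hqpos] at habs
  have hb2 : 0 ≤ b ^ 2 := by positivity
  -- The normalization q is exactly the worst case of |u|, from ‖ξ‖ ≤ 8K and ‖v‖ ≤ 2R. Trading one
  -- factor 8K for 2‖ζ‖ gains y/4 in `hr2`.
  have hr1 : |r| ≤ 1 := by
    refine le_of_mul_le_mul_right ?_ hqpos
    have e1 := mul_le_mul_of_nonneg_left hlin1 hb.le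
    have e2 := mul_le_mul_of_nonneg_left hsq1 hb2
    linarith
  have hr2 : |r| ≤ y / 4 := by
    refine le_of_mul_le_mul_right ?_ hqpos
    have e1 := mul_le_mul_of_nonneg_left hlin2 hb.le
    have e2 := mul_le_mul_of_nonneg_left hsq2 hb2
    rw [hq] at habs ⊢
    linarith
  have hr3 : r ≤ b / q * ζ v + 3 / 8 * y ^ 2 := by
    refine le_of_mul_le_mul_right ?_ hqpos
    have e0 : (b / q * ζ v + 3 / 8 * y ^ 2) * q = b * ζ v + 3 / 8 * y ^ 2 * q := by
      field_simp
    rw [hrq, e0, hq]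
    have e1 : ξ v ≤ ζ v + 6 * K * D.R * y ^ 2 := by
      have := mul_le_mul_of_nonneg_left hv (by positivity : 0 ≤ 3 * (K * y ^ 2))
      linarith
    have e2 := mul_le_mul_of_nonneg_left e1 hb.le
    have e3 := mul_le_mul_of_nonneg_left hsq3 hb2
    have e4 : 0 ≤ b ^ 2 * (K ^ 2 * y ^ 2) := by positivity
    linarith
  -- From e^r ≤ 1 + r + r² the coefficient of y² is 3/8 + 1/16 < 1.
  have hexp := (abs_le.mp (Real.abs_exp_sub_one_sub_id_le hr1)).2
  have hr4 : r ^ 2 ≤ y ^ 2 / 16 := by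
    have := mul_le_mul hr2 hr2 (abs_nonneg r) (by positivity)
    rw [abs_mul_abs_self] at this
    linarith
  have := sq_nonneg y
  linarith

theorem lintegral_exp_increment_le (hD : D.Assumptions P) [IsProbabilityMeasure P]
    [FiniteDimensional ℝ E] {β K lam : ℝ} {N : ℕ} (hN : 1 ≤ N)
    (hβ : 0 < β) (hσK : D.σ * √(N : ℝ) ≤ K)
    (hMK : D.M ≤ K) (hυK : D.υ * D.σ ≤ K) (hlam : lam = K + D.υ * D.σ) (s : D.State) :
    ∫⁻ w, ENNReal.ofReal (Real.exp
      (D.increment β lam s w / (16 * K * D.R * β⁻¹ + 96 * K ^ 2 * β⁻¹ ^ 2))) ∂P ≤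
      ENNReal.ofReal (Real.exp (1 / N)) := by
  have hN0 : (0 : ℝ) < N := by exact_mod_cast hN
  have hK : 0 < K := lt_of_lt_of_le (mul_pos hD.σ_pos (Real.sqrt_pos.mpr hN0)) hσK
  have hx : (s.1 : E) ∈ D.X := s.1.2.1
  have hpt := hD.exp_increment_div_le hβ hK hMK hυK hlam s
  set v := D.bregmanArgmin 0 1 s.2 - s.1
  set c := β⁻¹ / (16 * K * D.R * β⁻¹ + 96 * K ^ 2 * β⁻¹ ^ 2)
  have hi1 : Integrable (fun w => D.G s.1 w - D.gradφ s.1) P :=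
    (hD.integrable_G _ hx).sub (integrable_const _)
  have hi2 : Integrable (fun w => (D.G s.1 w - D.gradφ s.1) v) P :=
    (ContinuousLinearMap.apply ℝ ℝ v).integrable_comp hi1
  have hi3 := hD.integrable_sq _ hx
  have hzero : ∫ w, (D.G s.1 w - D.gradφ s.1) v ∂P = 0 := by
    have h := (ContinuousLinearMap.apply ℝ ℝ v).integral_comp_comm hi1
    simp only [ContinuousLinearMap.apply_apply] at h
    rw [h, integral_sub (hD.integrable_G _ hx) (integrable_const _), hD.unbiased _ hx,
      integral_const, probReal_univ, one_smul, sub_self, zero_apply]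
  have hi12 : Integrable (fun w => 1 + c * (D.G s.1 w - D.gradφ s.1) v) P :=
    (integrable_const 1).add (hi2.const_mul c)
  have hi : Integrable (fun w => 1 + c * (D.G s.1 w - D.gradφ s.1) v
      + (K ^ 2)⁻¹ * ‖D.G s.1 w - D.gradφ s.1‖ ^ 2) P := hi12.add (hi3.const_mul _)
  refine (lintegral_mono fun w => ENNReal.ofReal_le_ofReal (hpt w)).trans ?_
  rw [← ofReal_integral_eq_lintegral_ofReal hi
    (Eventually.of_forall fun w => (Real.exp_pos _).le.trans (hpt w))]
  refine ENNReal.ofReal_le_ofReal ?_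
  rw [integral_add hi12 (hi3.const_mul _), integral_add (integrable_const 1) (hi2.const_mul c),
    integral_const_mul, integral_const_mul, hzero, integral_const, probReal_univ, one_smul,
    mul_zero, add_zero]
  have hvar := hD.variance_le _ hx
  have h1 : (K ^ 2)⁻¹ * ∫ w, ‖D.G s.1 w - D.gradφ s.1‖ ^ 2 ∂P ≤ 1 / N := by
    rw [inv_mul_le_iff₀ (by positivity), mul_one_div, le_div_iff₀ hN0]
    refine (mul_le_mul_of_nonneg_right hvar hN0.le).trans ?_
    have := mul_self_le_mul_self (mul_nonneg hD.σ_pos.le (Real.sqrt_nonneg _)) hσK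
    have e := Real.mul_self_sqrt hN0.le
    calc D.σ ^ 2 * N = D.σ * √N * (D.σ * √N) := by
          rw [mul_mul_mul_comm, e]; ring
      _ ≤ K ^ 2 := by rw [sq]; exact this
  have h2 := Real.add_one_le_exp (1 / (N : ℝ))
  linarith

/-! ### From the error functional to the optimality gap -/

section Gap

variable {β lam : ℝ} {N : ℕ}

theorem iter_mem (hD : D.Assumptions P) (hβ : 0 < β) (ω : Fin N → Ω) (i : ℕ) :
    D.iter (fun _ => β) lam ω i ∈ D.X ∧ D.iter (fun _ => β) lam ω i ∈ D.proxDom := by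
  rw [hD.iter_eq_chain hβ]
  exact (chain (hD.step hβ lam) hD.initialState ω i).1.2

theorem convexOn_F (hD : D.Assumptions P) : ConvexOn ℝ D.X (D.F P) := hD.convex_φ.add hD.convex_ψ

theorem F_sub_le_eps (hD : D.Assumptions P) (hN : 1 ≤ N) (hβ : 0 < β)
    (hL : 2 * D.L ≤ β) (ω : Fin N → Ω) {z : E} (hz : z ∈ D.X) :
    D.F P (D.xhat (fun _ => β) lam ω) - D.F P z ≤
      β / N * D.eps (fun _ => β) N (D.iter (fun _ => β) lam ω) z := by
  set x := D.iter (fun _ => β) lam ω with hxdef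
  have hN0 : (0 : ℝ) < N := by exact_mod_cast hN
  have hx : ∀ i, x i ∈ D.X := fun i => (hD.iter_mem hβ ω i).1
  have hstep : ∀ i, D.F P (x (i + 1)) - D.F P z ≤
      β * (β⁻¹ * (D.gradφ (x i) (x (i + 1) - z) + D.ψ (x (i + 1)) - D.ψ z)
        + 1 / 2 * D.V (x i) (x (i + 1))) := by
    intro i
    have h1 := le_tangent_add_of_lipschitz hD.convex_φ hD.hasGrad_φ hD.lipschitz_grad (hx i)
      (hx (i + 1))
    have h2 := tangent_le_of_convexOn hD.convex_φ (hD.hasGrad_φ _ (hx i)) (hx i) hz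
    have h3 := hD.half_sq_le_V (hD.iter_mem (lam := lam) hβ ω i).2 (hx (i + 1))
    rw [← hxdef] at h3
    have h4 := mul_le_mul_of_nonneg_left h3 hβ.le
    -- The descent term (L/2)‖·‖² is at most (β/4)‖·‖² ≤ (β/2)V, which ε contains.
    have h5 := mul_le_mul_of_nonneg_right hL (sq_nonneg ‖x (i + 1) - x i‖)
    rw [mul_add, mul_inv_cancel_left₀ hβ.ne']
    unfold Data.F
    simp only [map_sub] at h1 h2 ⊢
    linarith
  have hJ := hD.convexOn_F.map_sum_le (t := Finset.range N) (w := fun _ => (N : ℝ)⁻¹)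
    (p := fun i => x (i + 1)) (fun _ _ => by positivity)
    (by rw [Finset.sum_const, Finset.card_range, nsmul_eq_mul, mul_inv_cancel₀ hN0.ne'])
    (fun i _ => hx (i + 1))
  rw [← Finset.smul_sum, ← Finset.smul_sum, smul_eq_mul] at hJ
  have hsum := Finset.sum_le_sum fun i (_ : i ∈ Finset.range N) => hstep i
  rw [Finset.sum_sub_distrib, ← Finset.mul_sum, Finset.sum_const, Finset.card_range,
    nsmul_eq_mul] at hsum
  have h6 := mul_le_mul_of_nonneg_left hsum (inv_nonneg.mpr hN0.le)
  rw [mul_sub, inv_mul_cancel_left₀ hN0.ne'] at h6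
  change D.F P ((N : ℝ)⁻¹ • ∑ i ∈ Finset.range N, x (i + 1)) - D.F P z ≤ _
  refine (sub_le_sub_right hJ _).trans (h6.trans_eq ?_)
  unfold eps
  ring

/-- A real `sSup` needs boundedness; the z-free bound of `eps_le` supplies it. -/
theorem eps_le_supEps (hD : D.Assumptions P) [FiniteDimensional ℝ E] (hβ : 0 < β)
    (ω : Fin N → Ω) {z : E} (hz : z ∈ D.X) :
    D.eps (fun _ => β) N (D.iter (fun _ => β) lam ω) z ≤ D.supEps (fun _ => β) lam ω := by
  refine le_csSup ⟨2 * (D.R ^ 2 * D.Θ) + ∑ i : Fin N, D.increment β lam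
    (chain (hD.step hβ lam) hD.initialState ω i) (ω i), ?_⟩ (mem_image_of_mem _ hz)
  rintro _ ⟨z', hz', rfl⟩
  exact hD.eps_le hβ lam ω hz'

theorem F_sub_Fmin_le (hD : D.Assumptions P) [FiniteDimensional ℝ E] (hN : 1 ≤ N) (hβ : 0 < β)
    (hL : 2 * D.L ≤ β) (ω : Fin N → Ω) :
    D.F P (D.xhat (fun _ => β) lam ω) - D.Fmin P ≤
      β / N * D.supEps (fun _ => β) lam ω := by
  have : D.F P (D.xhat (fun _ => β) lam ω) - β / N * D.supEps (fun _ => β) lam ω ≤ D.Fmin P := by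
    refine le_csInf ⟨_, mem_image_of_mem _ hD.x₀_mem⟩ ?_
    rintro _ ⟨z, hz, rfl⟩
    have h1 := hD.F_sub_le_eps (lam := lam) hN hβ hL ω hz
    have h2 := mul_le_mul_of_nonneg_left (hD.eps_le_supEps (lam := lam) hβ ω hz)
      (by positivity : 0 ≤ β / N)
    linarith
  linarith

theorem supEps_le (hD : D.Assumptions P) [FiniteDimensional ℝ E] (hβ : 0 < β)
    (ω : Fin N → Ω) : D.supEps (fun _ => β) lam ω ≤ 2 * (D.R ^ 2 * D.Θ)
      + ∑ i : Fin N, D.increment β lam (chain (hD.step hβ lam) hD.initialState ω i) (ω i) := by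
  refine csSup_le ⟨_, mem_image_of_mem _ hD.x₀_mem⟩ ?_
  rintro _ ⟨z, hz, rfl⟩
  exact hD.eps_le hβ lam ω hz

end Gap

/-- With high probability the error is bounded in terms of `K = max {σ √N, M}`. -/
theorem exists_event (hD : D.Assumptions P) [IsProbabilityMeasure P] [FiniteDimensional ℝ E]
    [BorelSpace E] {β : ℝ} {N : ℕ} (hN : 1 ≤ N) (hυ : D.υ ^ 2 ≤ (N : ℝ)) (hβ : 0 < β) (τ : ℝ) :
    ∃ A : Set (Fin N → Ω), MeasurableSet A ∧
      1 - Real.exp (-τ) ≤ (Measure.pi fun _ : Fin N => P).real A ∧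
      ∀ ω ∈ A, D.supEps (fun _ => β) (D.threshold N) ω ≤ 2 * (D.R ^ 2 * D.Θ)
        + (1 + τ) * (16 * max (D.σ * √(N : ℝ)) D.M * D.R * β⁻¹
          + 96 * max (D.σ * √(N : ℝ)) D.M ^ 2 * β⁻¹ ^ 2) := by
  set K := max (D.σ * √(N : ℝ)) D.M with hKdef
  set q := 16 * K * D.R * β⁻¹ + 96 * K ^ 2 * β⁻¹ ^ 2 with hq
  have hN0 : (0 : ℝ) < N := by exact_mod_cast hN
  have hK : 0 < K :=
    lt_of_lt_of_le (mul_pos hD.σ_pos (Real.sqrt_pos.mpr hN0)) (le_max_left _ _)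
  have hR := hD.R_pos
  have hqpos : 0 < q := by positivity
  have hυK : D.υ * D.σ ≤ K := by
    refine le_trans ?_ (le_max_left _ _)
    rw [mul_comm]
    exact mul_le_mul_of_nonneg_left (Real.le_sqrt_of_sq_le hυ) hD.σ_pos.le
  have hinc : Measurable fun p : D.State × Ω => D.increment β (D.threshold N) p.1 p.2 / q :=
    (hD.measurable_increment β _).div_const q
  have hstep := hD.measurable_step hβ (D.threshold N)
  refine ⟨_, ?_, le_measureReal_sum_chain_le (u := fun s w => D.increment β (D.threshold N) s w / q)
    hstep hinc hN (hD.lintegral_exp_increment_le hN hβ (le_max_left _ _) (le_max_right _ _) hυK rfl)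
    hD.initialState τ, fun ω hω => ?_⟩
  · exact measurableSet_le (measurable_sum_chain
      (u := fun s w => D.increment β (D.threshold N) s w / q) hstep hinc N _) measurable_const
  · refine (hD.supEps_le hβ ω).trans ?_
    have h1 : (∑ i : Fin N, D.increment β (D.threshold N)
        (chain (hD.step hβ (D.threshold N)) hD.initialState ω i) (ω i) / q) ≤ 1 + τ := hω
    rw [← Finset.sum_div, div_le_iff₀ hqpos] at h1
    linarith

end Data.Assumptions

theorem balanced_stepsize_bound {L σ R Θ τ n β : ℝ} (hL : 0 ≤ L) (hσ : 0 < σ) (hR : 0 < R)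
    (hΘ : 1 / 2 ≤ Θ) (hτ : 1 / 2 ≤ τ) (hn : 0 < n)
    (hβ : β = max (2 * L) (σ * √n / (R * √Θ))) :
    1 / n * (β * R ^ 2 * Θ + τ * R * max (σ * √n) (L * R)
        + τ * β⁻¹ * max (n * σ ^ 2) ((L * R) ^ 2)) ≤
      9 * max (L * R ^ 2 * max τ Θ / n) (τ * σ * R * √(Θ / n)) := by
  set m := max (L * R ^ 2 * max τ Θ / n) (τ * σ * R * √(Θ / n)) with hm
  obtain ⟨s, hs, hs2⟩ : ∃ s, 0 < s ∧ s ^ 2 = n :=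
    ⟨√n, Real.sqrt_pos.mpr hn, Real.sq_sqrt hn.le⟩
  obtain ⟨t, ht, ht2⟩ : ∃ t, 0 < t ∧ t ^ 2 = Θ :=
    ⟨√Θ, Real.sqrt_pos.mpr (by linarith), Real.sq_sqrt (by linarith)⟩
  have hsn : √n = s := by rw [← hs2, Real.sqrt_sq hs.le]
  have hst : √Θ = t := by rw [← ht2, Real.sqrt_sq ht.le]
  have hdiv : √(Θ / n) = t / s := by rw [Real.sqrt_div (by linarith), hsn, hst]
  rw [hsn, hst] at hβ
  rw [hsn]
  rw [hdiv] at hm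
  have m1 : L * R ^ 2 * τ ≤ m * n := by
    rw [← div_le_iff₀ hn]
    refine le_trans ?_ (le_max_left _ _)
    gcongr
    exact le_max_left _ _
  have m2 : L * R ^ 2 * Θ ≤ m * n := by
    rw [← div_le_iff₀ hn]
    refine le_trans ?_ (le_max_left _ _)
    gcongr
    exact le_max_right _ _
  have m3 : τ * σ * R * t * s ≤ m * n := by
    have h : τ * σ * R * (t / s) ≤ m := by rw [hm]; exact le_max_right _ _
    have := mul_le_mul_of_nonneg_right h hn.le
    have e : τ * σ * R * (t / s) * n = τ * σ * R * t * s := by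
      rw [← hs2]; field_simp
    rwa [e] at this
  have hβpos : 0 < β := by
    rw [hβ]; exact lt_max_of_lt_right (by positivity)
  have ht1 : 1 / 2 ≤ t := by
    by_contra hc
    push Not at hc
    nlinarith
  have b1 : β * R ^ 2 * Θ ≤ 4 * (m * n) := by
    have h1 : β ≤ 2 * L + σ * s / (R * t) := by
      rw [hβ]
      exact max_le (by linarith [show 0 ≤ σ * s / (R * t) by positivity]) (by linarith)
    have h2 := mul_le_mul_of_nonneg_right h1 (by positivity : 0 ≤ R ^ 2 * t ^ 2)
    have e : (2 * L + σ * s / (R * t)) * (R ^ 2 * t ^ 2)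
        = 2 * (L * R ^ 2 * t ^ 2) + σ * R * t * s := by
      field_simp
    rw [e, ht2] at h2
    have h3 : σ * R * t * s ≤ 2 * (τ * σ * R * t * s) := by
      have := mul_le_mul_of_nonneg_right hτ (by positivity : 0 ≤ σ * R * t * s)
      linarith
    linarith
  have b2 : τ * R * max (σ * s) (L * R) ≤ 3 * (m * n) := by
    have hτ0 : 0 < τ := by linarith
    have h1 : max (σ * s) (L * R) ≤ σ * s + L * R :=
      max_le (by linarith [mul_nonneg hL hR.le]) (by linarith [mul_pos hσ hs])
    have h2 := mul_le_mul_of_nonneg_left h1 (by positivity : 0 ≤ τ * R)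
    have h3 := mul_le_mul_of_nonneg_right ht1 (by positivity : 0 ≤ τ * σ * R * s)
    linarith
  have b3 : τ * β⁻¹ * max (n * σ ^ 2) ((L * R) ^ 2) ≤ 2 * (m * n) := by
    have hτ0 : 0 < τ := by linarith
    rw [mul_right_comm, ← div_eq_mul_inv, div_le_iff₀ hβpos]
    have h1 : 2 * L ≤ β := by rw [hβ]; exact le_max_left _ _
    have h2 : σ * s / (R * t) ≤ β := by rw [hβ]; exact le_max_right _ _
    have hmn : 0 ≤ m * n := le_trans (by positivity) m3
    rcases le_total (n * σ ^ 2) ((L * R) ^ 2) with h | h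
    · rw [max_eq_right h]
      have h3 := mul_le_mul m1 h1 (by positivity) hmn
      have : 0 ≤ m * n * β := by positivity
      nlinarith
    · rw [max_eq_left h]
      have h3 := mul_le_mul m3 h2 (by positivity) hmn
      have e : τ * σ * R * t * s * (σ * s / (R * t)) = τ * (n * σ ^ 2) := by
        rw [← hs2]; field_simp
      rw [e] at h3
      have : 0 ≤ m * n * β := by positivity
      linarith
  -- The three terms contribute 4 + 3 + 2 = 9.
  rw [one_div, inv_mul_le_iff₀ hn]
  linarith

end RSMD

end

/-! ### The main theorem -/

theorem theorem2 :
    ∃ C : ℝ, 0 < C ∧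
      ∀ (E : Type*) [NormedAddCommGroup E] [NormedSpace ℝ E] [FiniteDimensional ℝ E]
        [Nontrivial E] [MeasurableSpace E] [BorelSpace E]
        (Ω : Type*) [MeasurableSpace Ω] (P : Measure Ω) [IsProbabilityMeasure P]
        (D : RSMD.Data E Ω), D.Assumptions P →
      ∀ (N : ℕ), 1 ≤ N → D.υ ^ 2 ≤ (N : ℝ) →
      ∀ (βbar : ℝ), 0 < βbar → 2 * D.L ≤ βbar →
      ∀ (τ : ℝ),
        ∃ A : Set (Fin N → Ω), MeasurableSet A ∧
          1 - 2 * Real.exp (-τ) ≤ (Measure.pi fun _ : Fin N => P).real A ∧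
          ∀ ω ∈ A,
            D.F P (D.xhat (fun _ => βbar) (D.threshold N) ω) - D.Fmin P
                ≤ βbar / N * D.supEps (fun _ => βbar) (D.threshold N) ω ∧
            βbar / N * D.supEps (fun _ => βbar) (D.threshold N) ω
                ≤ C / N * (βbar * D.R ^ 2 * D.Θ + τ * D.R * max (D.σ * √(N : ℝ)) D.M
                    + τ * βbar⁻¹ * max (N * D.σ ^ 2) (D.M ^ 2)) ∧
            (βbar = max (2 * D.L) (D.σ * √(N : ℝ) / (D.R * √D.Θ)) →
              βbar / N * D.supEps (fun _ => βbar) (D.threshold N) ω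
                ≤ C * max (D.L * D.R ^ 2 * max τ D.Θ / N)
                    (τ * D.σ * D.R * √(D.Θ / N))) := by
  -- 2592 = 288 · 9: the general bound times the factor of `balanced_stepsize_bound`.
  refine ⟨2592, by norm_num, ?_⟩
  intro E _ _ _ _ _ _ Ω _ P _ D hD N hN hυ β hβ hL τ
  -- For τ ≤ log 2 the required probability is nonpositive and the empty event suffices. Otherwise τ
  -- ≥ 1/2, so 1 + τ ≤ 3τ, whence 288 = 3 · 96.
  rcases le_or_gt τ (Real.log 2) with hτ | hτ
  · refine ⟨∅, MeasurableSet.empty, ?_, fun ω hω => hω.elim⟩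
    rw [measureReal_empty]
    have h1 := Real.exp_le_exp.mpr (neg_le_neg hτ)
    rw [Real.exp_neg (Real.log 2), Real.exp_log two_pos] at h1
    linarith
  have hτ2 : 1 / 2 ≤ τ := by linarith [Real.log_two_gt_d9]
  obtain ⟨A, hA, hPA, hAω⟩ := hD.exists_event hN hυ hβ τ
  refine ⟨A, hA, by linarith [Real.exp_pos (-τ)], fun ω hω => ?_⟩
  have hN0 : (0 : ℝ) < N := by exact_mod_cast hN
  have hR := hD.R_pos
  have hσ := hD.σ_pos
  have hΘ := hD.half_le_Θ
  have hM : 0 ≤ D.M := mul_nonneg hD.L_nonneg hR.le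
  have hKsq : max (D.σ * √(N : ℝ)) D.M ^ 2 = max (N * D.σ ^ 2) (D.M ^ 2) := by
    have e : (D.σ * √(N : ℝ)) ^ 2 = N * D.σ ^ 2 := by
      rw [mul_pow, Real.sq_sqrt hN0.le, mul_comm]
    rw [← e]
    rcases le_total (D.σ * √(N : ℝ)) D.M with h | h
    · rw [max_eq_right h, max_eq_right (pow_le_pow_left₀ (by positivity) h 2)]
    · rw [max_eq_left h, max_eq_left (pow_le_pow_left₀ hM h 2)]
  have hbound : β / N * D.supEps (fun _ => β) (D.threshold N) ω ≤
      288 * (1 / N * (β * D.R ^ 2 * D.Θ + τ * D.R * max (D.σ * √(N : ℝ)) D.M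
        + τ * β⁻¹ * max (N * D.σ ^ 2) (D.M ^ 2))) := by
    have h1 := mul_le_mul_of_nonneg_left (hAω ω hω) (by positivity : 0 ≤ β / N)
    refine h1.trans ?_
    rw [← hKsq]
    set K := max (D.σ * √(N : ℝ)) D.M
    have hK : 0 ≤ K := hM.trans (le_max_right _ _)
    have e : β / N * (2 * (D.R ^ 2 * D.Θ)
        + (1 + τ) * (16 * K * D.R * β⁻¹ + 96 * K ^ 2 * β⁻¹ ^ 2))
        = 1 / N * (2 * (β * D.R ^ 2 * D.Θ) + (1 + τ) * (16 * (D.R * K) + 96 * (β⁻¹ * K ^ 2))) := by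
      field_simp
    rw [e, mul_left_comm 288]
    refine mul_le_mul_of_nonneg_left ?_ (by positivity)
    have h2 : 0 ≤ β * D.R ^ 2 * D.Θ := by positivity
    have h3 : (1 + τ) * (16 * (D.R * K) + 96 * (β⁻¹ * K ^ 2))
        ≤ (3 * τ) * (16 * (D.R * K) + 96 * (β⁻¹ * K ^ 2)) :=
      mul_le_mul_of_nonneg_right (by linarith) (by positivity)
    have h4 : 0 ≤ τ * (D.R * K) := by positivity
    linarith
  have hnn : 0 ≤ 1 / (N : ℝ) * (β * D.R ^ 2 * D.Θ + τ * D.R * max (D.σ * √(N : ℝ)) D.M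
        + τ * β⁻¹ * max (N * D.σ ^ 2) (D.M ^ 2)) := by
    have : 0 ≤ max (D.σ * √(N : ℝ)) D.M := hM.trans (le_max_right _ _)
    have : 0 ≤ max (N * D.σ ^ 2) (D.M ^ 2) := (sq_nonneg _).trans (le_max_right _ _)
    positivity
  refine ⟨hD.F_sub_Fmin_le hN hβ hL ω, ?_, fun hβeq => ?_⟩
  · exact hbound.trans ((mul_le_mul_of_nonneg_right (by norm_num : (288 : ℝ) ≤ 2592) hnn).trans_eq
      (by ring))
  · have := RSMD.balanced_stepsize_bound hD.L_nonneg hσ hR hΘ hτ2 hN0 hβeq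
    rw [RSMD.Data.M] at hbound
    linarith
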